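/- \textbf{Setting.} Let $q\in\mathbb C^*$ with $|q|<1$, and let $$\vartheta(x)=\big(x^{1/2}-x^{-1/2}\big)\varphi(qx)\varphi(q/x),\qquad \varphi(x)=\prod_{s=0}^{\infty}(1-q^sx)$$ be the skew Jacobi theta function. Let $n$ be a non-negative integer, let $z=(z_1,\dots,z_n)$, $\mu=(\mu_1,\dots,\mu_n)$ and $\hbar$ be non-zero complex parameters, and fix a square root of each of them; for a Laurent monomial $x$ in the parameters, $x^{1/2}$ always means the same Laurent monomial in the chosen square roots. For a permutation $I=(I_1,\dots,I_n)\in\mathfrak S_n$ and $0\le k\le n$ let $i^{(k)}_1<\dots<i^{(k)}_k$ be the elements of $\{I_1,\dots,I_k\}$ in increasing order. For variables $t=(t^{(k)}_a)_{1\le a\le k\le n-1}$, and with $t^{(n)}_i=z_i$, put $$U_I(t,z,\hbar,\mu)=\prod_{k=1}^{n-1}\frac{\prod_{a=1}^{k}\prod_{c=1}^{k+1}\psi_{I,k,a,c}\big(t^{(k+1)}_c/t^{(k)}_a\big)}{\prod_{1\le a<b\le k}\vartheta\big(t^{(k)}_a\hbar/t^{(k)}_b\big)\,\vartheta\big(t^{(k)}_b/t^{(k)}_a\big)},$$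 $$\psi_{I,k,a,c}(x)=\begin{cases}\vartheta(\hbar x),& i^{(k+1)}_c<i^{(k)}_a,\\ \vartheta\big(x\,\hbar^{1-p}\,\mu_{k+1}/\mu_{j}\big),& i^{(k+1)}_c=i^{(k)}_a,\\ \vartheta(x),& i^{(k+1)}_c>i^{(k)}_a,\end{cases}$$ where $j$ is defined by $I_j=i^{(k)}_a$, and $p=1$ if $I_{k+1}<i^{(k)}_a$, $p=0$ if $I_{k+1}\ge i^{(k)}_a$. The elliptic weight function $W_I(t,z,\hbar,\mu)$ is the symmetrization of $U_I$ (the sum over all permutations) in each of the groups of variables $t^{(k)}=(t^{(k)}_1,\dots,t^{(k)}_k)$, $1\le k\le n-1$. For $J\in\mathfrak S_n$ let $z_J$ denote the substitution $t^{(k)}_a=z_{j^{(k)}_a}$, where $j^{(k)}_1<\dots<j^{(k)}_k$ are the elements of $\{J_1,\dots,J_k\}$. The restriction matrix is $$A_{I,J}(z,\mu)=W_I(z_J,z,\hbar,\mu),\qquad I,J\in\mathfrak S_n .$$ \textbf{Theorem.} Let $\sigma_0=(n,n-1,\dots,1)$ be the longest permutation in $\mathfrak S_n$, and write $\sigma\cdot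 I$ for the permutation $m\mapsto I_{\sigma(m)}$. Then for all $I,J\in\mathfrak S_n$ $$A_{I,J}(z,\mu)=(-1)^{n(n-1)/2}\,A_{J^{-1}\cdot\sigma_0,\;I^{-1}\cdot\sigma_0}\big(\mu_{\sigma_0(1)},\dots,\mu_{\sigma_0(n)},\,z_1^{-1},\dots,z_n^{-1}\big)$$ as an identity of meromorphic functions of $z,\mu,\hbar$ (with the same $\hbar$ on both sides); that is, it holds whenever none of the denominators in the two symmetrized sums vanishes. Here the chosen square root of $z_i^{-1}$ is the inverse of the chosen square root of $z_i$. -/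

import Mathlib

noncomputable section

namespace FlagMirror

open Finset

/-- The infinite product `φ(x) = ∏_{s ≥ 0} (1 - q^s x)`. -/
def phi (q x : ℂ) : ℂ := ∏' s : ℕ, (1 - q ^ s * x)

/-- The skew Jacobi theta function `θ(x) = (x^{1/2} - x^{-1/2}) φ(q x) φ(q / x)`.
It is double-valued in `x`, so it is written as a function of the chosen square root
`r = x^{1/2}`, that is, `x = r ^ 2`. All the parameters below (`z`, `μ`, `ħ` and the Chern roots
`t`) are likewise given by chosen square roots; products and quotients of parameters then
correspond to products and quotients of these square roots. -/
def theta (q r : ℂ) : ℂ := (r - r⁻¹) * phi q (q * r ^ 2) * phi q (q / r ^ 2)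

variable {n : ℕ}

/-- The set `{I_1, …, I_k}`, for `0 ≤ k ≤ n`. Permutations are written with indices starting
from `0`, so that `I_{m+1}` is `I m` for `m : Fin n`. -/
def initialSet (I : Equiv.Perm (Fin n)) (k : Fin (n + 1)) : Finset (Fin n) :=
  (univ.filter fun m : Fin n => (m : ℕ) < k).map I.toEmbedding

theorem card_initialSet (I : Equiv.Perm (Fin n)) (k : Fin (n + 1)) :
    (initialSet I k).card = (k : ℕ) := by
  rw [initialSet, card_map, Fin.card_filter_val_lt]
  exact min_eq_right (Nat.lt_succ_iff.mp k.isLt)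

/-- The ordered indices `i^{(k)}_1 < ⋯ < i^{(k)}_k`, the increasing enumeration of
`{I_1, …, I_k}`. -/
def sortedIndex (I : Equiv.Perm (Fin n)) (k : Fin (n + 1)) : Fin k ↪o Fin n :=
  (initialSet I k).orderEmbOfFin (card_initialSet I k)

/-- `p_{I,j}(m) = 1` if `I_j < m` and `0` if `I_j ≥ m`. -/
def pFun (I : Equiv.Perm (Fin n)) (j m : Fin n) : ℤ := if I j < m then 1 else 0

/-- The function `ψ_{I,k,a,c}`, for `0 ≤ k ≤ n - 1`, `1 ≤ a ≤ k`, `1 ≤ c ≤ k + 1`, as a function of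
the square root `x` of its argument; `h` and `μ` are square roots of `ħ` and of the dynamical
parameters. The parameter `μ_{k+1}` is `μ k`, the number `I_{k+1}` is `I k`, and the index `j` with
`I_j = i^{(k)}_a` is `I.symm (i^{(k)}_a)`. -/
def psi (q h : ℂ) (μ : Fin n → ℂ) (I : Equiv.Perm (Fin n)) (k : Fin n)
    (a : Fin k.castSucc) (c : Fin k.succ) (x : ℂ) : ℂ :=
  if sortedIndex I k.succ c < sortedIndex I k.castSucc a then
    theta q (h * x)
  else if sortedIndex I k.succ c = sortedIndex I k.castSucc a then
    theta q (x * h ^ (1 - pFun I k (sortedIndex I k.castSucc a)) * μ k /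
      μ (I.symm (sortedIndex I k.castSucc a)))
  else
    theta q x

/-- The Chern roots `t^{(k)}_a`, `1 ≤ a ≤ k ≤ n - 1` (there are none for `k = 0`). -/
abbrev ChernRoots (n : ℕ) : Type := (k : Fin n) → Fin k → ℂ

/-- The Chern roots extended to the level `n` by the convention `t^{(n)}_i = z_i`. -/
def extendRoots (t : ChernRoots n) (z : Fin n → ℂ) : (k : Fin (n + 1)) → Fin k → ℂ :=
  Fin.snoc (α := fun k : Fin (n + 1) => Fin k → ℂ) t z

/-- The function `U_I(t, z, ħ, μ)`. The factor with `k = 0` is an empty product. -/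
def preWeight (q h : ℂ) (I : Equiv.Perm (Fin n)) (t : ChernRoots n) (z μ : Fin n → ℂ) : ℂ :=
  ∏ k : Fin n,
    (∏ a : Fin k.castSucc, ∏ c : Fin k.succ,
        psi q h μ I k a c (extendRoots t z k.succ c / extendRoots t z k.castSucc a)) /
      (∏ a : Fin k, ∏ b ∈ Ioi a, theta q (t k a * h / t k b) * theta q (t k b / t k a))

/-- The elliptic weight function `W_I(t, z, ħ, μ)`: the symmetrization (sum over all permutations)
of `U_I` in each of the groups of variables `t^{(1)}, …, t^{(n-1)}`. -/
def weight (q h : ℂ) (I : Equiv.Perm (Fin n)) (t : ChernRoots n) (z μ : Fin n → ℂ) : ℂ :=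
  ∑ τ : (k : Fin n) → Equiv.Perm (Fin k), preWeight q h I (fun k a => t k (τ k a)) z μ

/-- The restriction `z_J` of the Chern roots to the fixed point `J`: `t^{(k)}_a = z_{j^{(k)}_a}`,
where `j^{(k)}_1 < ⋯ < j^{(k)}_k` is the increasing enumeration of `{J_1, …, J_k}`. -/
def fixedPointRoots (z : Fin n → ℂ) (J : Equiv.Perm (Fin n)) : ChernRoots n :=
  fun k a => z (sortedIndex J k.castSucc a)

/-- The restriction matrix `A_{I,J}(z, μ) = W_I(z_J, z, ħ, μ)`. -/
def restrictionMatrix (q h : ℂ) (I J : Equiv.Perm (Fin n)) (z μ : Fin n → ℂ) : ℂ :=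
  weight q h I (fixedPointRoots z J) z μ

/-- None of the denominators of the symmetrized sum `W_I(t, z, ħ, μ)` vanishes at `t`
(they do not depend on `I`, `z`, `μ`). -/
def DenominatorsNonzero (q h : ℂ) (t : ChernRoots n) : Prop :=
  ∀ (k : Fin n) (a b : Fin k), a ≠ b →
    theta q (t k a * h / t k b) ≠ 0 ∧ theta q (t k b / t k a) ≠ 0

end FlagMirror

end

/-! Up to a common factor, the products `θ(x a) θ(x b)` with a fixed value of `a b` are theta
functions of degree two in `x ^ 2`, and comparing Laurent coefficients shows that these form a space
of dimension at most two. The linear relation between three such products is Fay's four-term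
identity. For parameters in general position, the symmetry uses nothing else about `θ` than this
identity and its oddness.

Label the Chern roots by the time at which their index appears in the permutation. Level by level,
Fay's identity then gives an exchange relation that expresses the row `s I` of the restriction
matrix, for a simple transposition `s`, through the row `I` at the parameters `z` and `s z`. So the
matrix is determined by its row `I = 1`, whose only non-zero entry is the diagonal one, an explicit
product. By the same uniqueness argument the columns satisfy an exchange relation too, in which `s`
acts on `μ` instead of `z`. The mirror symmetry interchanges the two relations, so both sides of the
theorem satisfy the first one, and their rows `I = 1` agree up to the sign, which
comes from the oddness of `θ`.

For arbitrary parameters, both sides are continuous where their denominators do not vanish, and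
generic parameters are dense. -/

noncomputable section

namespace FlagMirror

open Finset

section Theta

theorem circleIntegral_comp_mul (c : ℂ) (R : ℝ) (g : ℂ → ℂ) :
    (∮ X in C(0, ‖c‖ * R), g X) = c * ∮ X in C(0, R), g (c * X) := by
  have hc : circleMap 0 ‖c‖ c.arg = c := by simp [circleMap]
  have hmul (t : ℝ) : c * circleMap 0 R t = circleMap 0 (‖c‖ * R) (t + c.arg) := by
    rw [← hc, circleMap_zero_mul, hc, add_comm]
  have hper : Function.Periodic (fun t => deriv (circleMap 0 (‖c‖ * R)) t •
      g (circleMap 0 (‖c‖ * R) t)) (2 * Real.pi) := fun t => by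
    simp only [deriv_circleMap, periodic_circleMap 0 (‖c‖ * R) t]
  calc (∮ X in C(0, ‖c‖ * R), g X)
    _ = ∫ t in (0 : ℝ)..2 * Real.pi, deriv (circleMap 0 (‖c‖ * R)) (t + c.arg) •
        g (circleMap 0 (‖c‖ * R) (t + c.arg)) := by
      rw [intervalIntegral.integral_comp_add_right (fun t => deriv (circleMap 0 (‖c‖ * R)) t •
        g (circleMap 0 (‖c‖ * R) t)), zero_add, add_comm (2 * Real.pi),
        hper.intervalIntegral_add_eq c.arg 0, zero_add, circleIntegral]
    _ = c * ∮ X in C(0, R), g (c * X) := by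
      rw [circleIntegral, ← intervalIntegral.integral_const_mul]
      simp only [deriv_circleMap, ← hmul, smul_eq_mul, mul_assoc]

/-- The `m`-th moment `∮ X ^ m g(X) dX` over the unit circle. Up to the factor `2πi` it is the
coefficient of `X ^ (-m - 1)` in the Laurent expansion of `g` on `ℂ ∖ {0}`. -/
def circleMoment (g : ℂ → ℂ) (m : ℤ) : ℂ := ∮ X in C(0, 1), X ^ m * g X

variable {g : ℂ → ℂ}

theorem differentiableAt_zpow_mul (hg : DifferentiableOn ℂ g {0}ᶜ) (m : ℤ) {X : ℂ} (hX : X ≠ 0) :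
    DifferentiableAt ℂ (fun X => X ^ m * g X) X :=
  (differentiableAt_zpow.mpr (.inl hX)).mul
    (hg.differentiableAt (isOpen_compl_singleton.mem_nhds hX))

theorem circleIntegral_zpow_mul_eq_circleMoment (hg : DifferentiableOn ℂ g {0}ᶜ) (m : ℤ) {R : ℝ}
    (hR : 0 < R) : (∮ X in C(0, R), X ^ m * g X) = circleMoment g m := by
  have hle {r R : ℝ} (hr : 0 < r) (hrR : r ≤ R) :
      (∮ X in C(0, R), X ^ m * g X) = ∮ X in C(0, r), X ^ m * g X := by
    refine Complex.circleIntegral_eq_of_differentiable_on_annulus_off_countable hr hrR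
      Set.countable_empty (fun X hX => ?_) fun X hX => differentiableAt_zpow_mul hg m ?_
    · refine (differentiableAt_zpow_mul hg m ?_).continuousAt.continuousWithinAt
      rintro rfl
      exact hX.2 (Metric.mem_ball_self hr)
    · rintro rfl
      exact hX.1.2 (Metric.mem_closedBall_self hr.le)
  obtain h | h := le_total 1 R
  exacts [hle one_pos h, (hle hR h).symm]

theorem eq_zero_of_circleMoment_eq_zero (hg : DifferentiableOn ℂ g {0}ᶜ)
    (h : ∀ m, circleMoment g m = 0) {X : ℂ} (hX : X ≠ 0) : g X = 0 := by
  have hT : Fact (0 < 2 * Real.pi) := ⟨Real.two_pi_pos⟩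
  have hR : 0 < ‖X‖ := norm_pos_iff.mpr hX
  let f : C(AddCircle (2 * Real.pi), ℂ) := ⟨fun t => g (‖X‖ * t.toCircle), by
    refine hg.continuousOn.comp_continuous (by fun_prop) fun t => ?_
    simp [hX]⟩
  have hf (t : ℝ) : f t = g (circleMap 0 ‖X‖ t) := by
    simp [f, AddCircle.toCircle_apply_mk, circleMap]
  have hcoeff : fourierCoeff f = 0 := by
    funext m
    have hm : (∮ Y in C(0, ‖X‖), Y ^ (-m - 1) * g Y) = 0 := by
      rw [circleIntegral_zpow_mul_eq_circleMoment hg _ hR, h]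
    have hterm (t : ℝ) : deriv (circleMap 0 ‖X‖) t •
          (circleMap 0 ‖X‖ t ^ (-m - 1) * g (circleMap 0 ‖X‖ t)) =
        Complex.I * ‖X‖ ^ (-m) * (fourier (-m) (t : AddCircle (2 * Real.pi)) • f t) := by
      have hexp : fourier (-m) (t : AddCircle (2 * Real.pi)) =
          Complex.exp (t * Complex.I) ^ (-m) := by
        rw [fourier_coe_apply, ← Complex.exp_int_mul]
        congr 1
        push_cast
        field_simp
      rw [hf, hexp, deriv_circleMap, smul_eq_mul, smul_eq_mul,
        zpow_sub_one₀ (circleMap_ne_center hR.ne'), circleMap_zero, mul_zpow]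
      have : (‖X‖ : ℂ) ≠ 0 := by simpa using hX
      field_simp
    simp only [circleIntegral, hterm, intervalIntegral.integral_const_mul] at hm
    rw [fourierCoeff_eq_intervalIntegral f m 0, zero_add,
      (mul_eq_zero.mp hm).resolve_left (by simp [hX, zpow_ne_zero]), smul_zero, Pi.zero_apply]
  have hsum := has_pointwise_sum_fourier_series_of_summable (f := f)
    (hcoeff ▸ summable_zero) (X.arg : ℝ)
  simp only [hcoeff, Pi.zero_apply, zero_smul, hf] at hsum
  simpa [circleMap] using hsum.unique hasSum_zero

/-- Holomorphic functions on `ℂ ∖ {0}` with the quasi-periodicity `X ^ d g(q X) = c g(X)`. -/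
structure IsThetaFunction (q c : ℂ) (d : ℕ) (g : ℂ → ℂ) : Prop where
  differentiableOn : DifferentiableOn ℂ g {0}ᶜ
  pow_mul_comp_mul : ∀ X ≠ 0, X ^ d * g (q * X) = c * g X

variable {q c : ℂ} {d : ℕ}

theorem IsThetaFunction.circleMoment_add (hq : q ≠ 0) (hg : IsThetaFunction q c d g) (m : ℤ) :
    circleMoment g (m + d) = c * q ^ (m + d + 1) * circleMoment g m := by
  have h := circleIntegral_comp_mul q 1 fun X => X ^ (m + d) * g X
  rw [mul_one, circleIntegral_zpow_mul_eq_circleMoment hg.differentiableOn _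
    (norm_pos_iff.mpr hq)] at h
  rw [h, circleMoment, ← circleIntegral.integral_const_mul, ← circleIntegral.integral_const_mul]
  refine circleIntegral.integral_congr zero_le_one fun X hX => ?_
  have hX0 : X ≠ 0 := by
    rintro rfl
    simp at hX
  have hqp := hg.pow_mul_comp_mul X hX0
  simp only [mul_zpow, zpow_add₀ hX0, zpow_add₀ hq, zpow_natCast, zpow_one]
  linear_combination q * q ^ m * q ^ d * X ^ m * hqp

theorem IsThetaFunction.eq_zero (hq : q ≠ 0) (hc : c ≠ 0) (hd : d ≠ 0)
    (hg : IsThetaFunction q c d g) (h : ∀ m : Fin d, circleMoment g m = 0) {X : ℂ} (hX : X ≠ 0) :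
    g X = 0 := by
  have hper : Function.Periodic (fun m => circleMoment g m = 0) (d : ℤ) := fun m => by
    simp [hg.circleMoment_add hq, hc, hq, zpow_ne_zero]
  refine eq_zero_of_circleMoment_eq_zero hg.differentiableOn (fun m => ?_) hX
  have hlt : m % d < d := Int.emod_lt_of_pos m (by lia)
  have hnn := Int.emod_nonneg m (b := d) (by lia)
  lift m % (d : ℤ) to ℕ using hnn with r hr
  rw [← Int.emod_add_mul_ediv m d, ← hr, mul_comm]
  exact ((hper.int_mul (m / d)) r).mpr (h ⟨r, by lia⟩)

theorem IsThetaFunction.sum {ι : Type*} [Fintype ι] {g : ι → ℂ → ℂ}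
    (hg : ∀ i, IsThetaFunction q c d (g i)) (v : ι → ℂ) :
    IsThetaFunction q c d fun X => ∑ i, v i * g i X where
  differentiableOn := DifferentiableOn.fun_sum fun i _ => (hg i).differentiableOn.const_mul (v i)
  pow_mul_comp_mul X hX := by
    rw [mul_sum, mul_sum]
    refine sum_congr rfl fun i _ => ?_
    linear_combination v i * (hg i).pow_mul_comp_mul X hX

theorem circleMoment_sum {ι : Type*} [Fintype ι] {g : ι → ℂ → ℂ}
    (hg : ∀ i, DifferentiableOn ℂ (g i) {0}ᶜ) (v : ι → ℂ) (m : ℤ) :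
    circleMoment (fun X => ∑ i, v i * g i X) m = ∑ i, v i * circleMoment (g i) m := by
  simp only [circleMoment, ← circleIntegral.integral_const_mul, mul_sum, mul_left_comm _ (v _)]
  refine circleIntegral.integral_fun_sum fun i _ =>
    ContinuousOn.circleIntegrable zero_le_one fun X hX => ?_
  have hX0 : X ≠ 0 := by
    rintro rfl
    simp at hX
  exact ((differentiableAt_zpow_mul (hg i) m hX0).const_mul (v i)).continuousAt.continuousWithinAt

theorem IsThetaFunction.exists_linear_relation {ι : Type*} [Fintype ι] {g : ι → ℂ → ℂ}
    (hq : q ≠ 0) (hc : c ≠ 0) (hd : d ≠ 0) (hg : ∀ i, IsThetaFunction q c d (g i))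
    (hι : d < Fintype.card ι) :
    ∃ v : ι → ℂ, v ≠ 0 ∧ ∀ X ≠ 0, ∑ i, v i * g i X = 0 := by
  have hdep : ¬ LinearIndependent ℂ fun i (m : Fin d) => circleMoment (g i) m := fun hli => by
    simpa using hli.fintype_card_le_finrank.trans_lt' hι
  obtain ⟨v, hv, i, hi⟩ := Fintype.not_linearIndependent_iff.mp hdep
  refine ⟨v, fun h => hi (congrFun h i), fun X hX =>
    (IsThetaFunction.sum hg v).eq_zero hq hc hd (fun m => ?_) hX⟩
  rw [circleMoment_sum fun i => (hg i).differentiableOn]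
  simpa using congrFun hv m

theorem multipliable_phi (hq : ‖q‖ < 1) (x : ℂ) :
    Multipliable fun s : ℕ => 1 - q ^ s * x := by
  simp_rw [sub_eq_add_neg]
  refine multipliable_one_add_of_summable ?_
  simpa using (summable_geometric_of_lt_one (norm_nonneg _) hq).mul_right ‖x‖

theorem phi_eq (hq : ‖q‖ < 1) (x : ℂ) : phi q x = (1 - x) * phi q (q * x) := by
  have h : (fun s : ℕ => 1 - q ^ (s + 1) * x) = fun s : ℕ => 1 - q ^ s * (q * x) := by
    funext s
    ring
  rw [phi, tprod_eq_zero_mul' (by rw [h]; exact multipliable_phi hq _), h, phi]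
  simp

theorem differentiable_phi (hq : ‖q‖ < 1) : Differentiable ℂ (phi q) := by
  intro x
  have h : HasProdLocallyUniformlyOn (fun (s : ℕ) (x : ℂ) => 1 + -(q ^ s * x))
      (fun x => ∏' s : ℕ, (1 + -(q ^ s * x))) (Metric.ball 0 (‖x‖ + 1)) := by
    refine Summable.hasProdLocallyUniformlyOn_nat_one_add Metric.isOpen_ball
      ((summable_geometric_of_lt_one (norm_nonneg _) hq).mul_right (‖x‖ + 1))
      (.of_forall fun s y hy => ?_) fun s => by fun_prop
    rw [norm_neg, norm_mul, norm_pow]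
    gcongr
    simpa using (Metric.mem_ball.mp hy).le
  have hd := h.differentiableOn (.of_forall fun _ => by
    simpa [Finset.prod_fn] using DifferentiableOn.finsetProd (fun _ _ => by fun_prop))
      Metric.isOpen_ball
  have := (hd x (by simp)).differentiableAt (Metric.isOpen_ball.mem_nhds (by simp))
  refine this.congr_of_eventuallyEq (.of_forall fun y => ?_)
  simp [phi, sub_eq_add_neg]

theorem phi_ne_zero (hq : ‖q‖ < 1) {x : ℂ} (hx : ∀ s : ℕ, q ^ s * x ≠ 1) : phi q x ≠ 0 := by
  have h := tprod_one_add_ne_zero_of_summable (f := fun s : ℕ => -(q ^ s * x))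
    (fun s => by
      rw [← sub_eq_add_neg, sub_ne_zero]
      exact (hx s).symm)
    (by simpa using (summable_geometric_of_lt_one (norm_nonneg _) hq).mul_right ‖x‖)
  simpa [phi, sub_eq_add_neg] using h

theorem theta_inv (r : ℂ) : theta q r⁻¹ = -theta q r := by
  simp only [theta, inv_inv, inv_pow, div_inv_eq_mul, ← div_eq_mul_inv]
  ring

theorem theta_one : theta q 1 = 0 := by simp [theta]

theorem continuousAt_theta (hq : ‖q‖ < 1) {r : ℂ} (hr : r ≠ 0) :
    ContinuousAt (theta q) r := by
  have hc := (differentiable_phi hq).continuous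
  have h1 : ContinuousAt (fun r : ℂ => phi q (q / r ^ 2)) r :=
    hc.continuousAt.comp (continuousAt_const.div (by fun_prop) (pow_ne_zero 2 hr))
  have h2 : ContinuousAt (fun r : ℂ => phi q (q * r ^ 2)) r :=
    (hc.comp (by fun_prop)).continuousAt
  exact ((continuousAt_id.sub (continuousAt_id.inv₀ hr)).mul h2).mul h1

theorem theta_ne_zero (hq : ‖q‖ < 1) {r : ℂ} (hr : r ≠ 0)
    (h : ∀ k : ℤ, r ^ 2 ≠ q ^ k) : theta q r ≠ 0 := by
  refine mul_ne_zero (mul_ne_zero ?_ (phi_ne_zero hq fun s hs => ?_))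
    (phi_ne_zero hq fun s hs => ?_)
  · intro h0
    apply h 0
    field_simp at h0
    simpa [sub_eq_zero] using h0
  · apply h (-(s + 1 : ℕ))
    rw [zpow_neg, zpow_natCast]
    refine eq_inv_of_mul_eq_one_right ?_
    rw [← hs]
    ring
  · apply h (s + 1 : ℕ)
    rw [zpow_natCast]
    field_simp at hs
    rw [← hs]
    ring

/-- The theta function without its half-integral power prefactor, `φ(X) φ(q / X)`. -/
def phiPair (q X : ℂ) : ℂ := phi q X * phi q (q / X)

theorem theta_eq (hq : ‖q‖ < 1) {r : ℂ} (hr : r ≠ 0) :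
    theta q r = -r⁻¹ * phiPair q (r ^ 2) := by
  rw [theta, phiPair, phi_eq hq (r ^ 2)]
  field_simp
  ring

theorem mul_phiPair (hq0 : q ≠ 0) (hq : ‖q‖ < 1) {X : ℂ} (hX : X ≠ 0) :
    X * phiPair q (q * X) = -phiPair q X := by
  rw [phiPair, phiPair, phi_eq hq X, phi_eq hq (q / (q * X))]
  have h : q * (q / (q * X)) = q / X := by field_simp
  rw [h]
  field_simp
  ring

theorem differentiableAt_phiPair (hq : ‖q‖ < 1) {X : ℂ} (hX : X ≠ 0) :
    DifferentiableAt ℂ (phiPair q) X :=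
  (differentiable_phi hq X).mul
    ((differentiable_phi hq (q / X)).fun_comp' X (by fun_prop (disch := exact hX)))

theorem isThetaFunction_phiPair_mul (hq0 : q ≠ 0) (hq : ‖q‖ < 1) {a b : ℂ} (ha : a ≠ 0)
    (hb : b ≠ 0) :
    IsThetaFunction q (a * b)⁻¹ 2 fun X => phiPair q (a * X) * phiPair q (b * X) where
  differentiableOn X hX := by
    have hcomp {a : ℂ} (ha : a ≠ 0) : DifferentiableAt ℂ (fun X => phiPair q (a * X)) X :=
      (differentiableAt_phiPair hq (mul_ne_zero ha hX)).fun_comp' X (by fun_prop)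
    exact ((hcomp ha).mul (hcomp hb)).differentiableWithinAt
  pow_mul_comp_mul X hX := by
    have hA := mul_phiPair hq0 hq (mul_ne_zero ha hX)
    have hB := mul_phiPair hq0 hq (mul_ne_zero hb hX)
    rw [mul_left_comm a, mul_left_comm b, eq_inv_mul_iff_mul_eq₀ (mul_ne_zero ha hb)]
    linear_combination (b * X * phiPair q (q * (b * X))) * hA - phiPair q (a * X) * hB

theorem exists_theta_relation (hq0 : q ≠ 0) (hq : ‖q‖ < 1) {e : ℂ} (he : e ≠ 0)
    {a b : Fin 3 → ℂ} (hab : ∀ i, a i * b i = e) :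
    ∃ v : Fin 3 → ℂ, v ≠ 0 ∧ ∀ x ≠ 0, ∑ i, v i * (theta q (x * a i) * theta q (x * b i)) = 0 := by
  have ha i : a i ≠ 0 := left_ne_zero_of_mul (hab i ▸ he)
  have hb i : b i ≠ 0 := right_ne_zero_of_mul (hab i ▸ he)
  obtain ⟨v, hv, h⟩ := IsThetaFunction.exists_linear_relation (c := (e ^ 2)⁻¹) hq0 (by simpa)
    two_ne_zero (fun i => by
      simpa only [← hab i, mul_pow] using isThetaFunction_phiPair_mul hq0 hq
        (pow_ne_zero 2 (ha i)) (pow_ne_zero 2 (hb i))) (by simp)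
  refine ⟨v, hv, fun x hx => ?_⟩
  rw [← mul_zero (x ^ 2 * e)⁻¹, ← h (x ^ 2) (pow_ne_zero 2 hx), mul_sum]
  refine sum_congr rfl fun i _ => ?_
  rw [theta_eq hq (mul_ne_zero hx (ha i)), theta_eq hq (mul_ne_zero hx (hb i)), mul_pow, mul_pow,
    ← hab i, mul_comm (x ^ 2), mul_comm (x ^ 2)]
  ring

theorem theta_fay_of_ne_zero (hq0 : q ≠ 0) (hq : ‖q‖ < 1) {x y l m : ℂ} (hx : x ≠ 0)
    (hy : y ≠ 0) (hl : l ≠ 0) (hm : m ≠ 0) (hyl : theta q y * theta q l ≠ 0) :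
    theta q (x * l) * theta q (y * m) * theta q (l * m) * theta q (y / x) =
      theta q y * theta q l * theta q (x * l * m) * theta q (y * m / x) -
        theta q x * theta q m * theta q (y * l * m) * theta q (x * l / y) := by
  obtain ⟨v, hv, h⟩ := exists_theta_relation hq0 hq (div_ne_zero hl hy)
    (a := ![l, l * m, 1]) (b := ![y⁻¹, (y * m)⁻¹, l / y]) fun i => by
      fin_cases i <;> simp [field]
  simp only [Fin.sum_univ_three, Matrix.cons_val] at h
  have h₁ := h 1 one_ne_zero
  have hxy := h y hy
  have hx := h x hx
  have hinv (r s : ℂ) : theta q (r * s⁻¹) = -theta q (s / r) := by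
    rw [← theta_inv, inv_div, div_eq_mul_inv]
  simp only [one_mul, theta_one, theta_inv, zero_mul, mul_zero, add_zero] at h₁
  rw [mul_inv_cancel₀ hy, theta_one, hinv, mul_div_cancel_left₀ m hy,
    mul_div_cancel₀ l hy] at hxy
  rw [hinv, hinv] at hx
  simp only [← mul_assoc, ← mul_div_assoc, mul_one] at hxy hx
  have hv1 : v 1 ≠ 0 := fun hv1 => hv <| funext fun i => by
    have : v 0 * (theta q y * theta q l) = 0 := by
      linear_combination -h₁ - theta q (l * m) * theta q (y * m) * hv1
    have : v 2 * (theta q y * theta q l) = 0 := by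
      linear_combination hxy + theta q (y * l * m) * theta q m * hv1
    fin_cases i <;> simp_all
  refine mul_left_cancel₀ hv1 ?_
  linear_combination theta q y * theta q l * hx - theta q (x * l) * theta q (y / x) * h₁ -
    theta q x * theta q (x * l / y) * hxy

theorem theta_fay (hq0 : q ≠ 0) (hq : ‖q‖ < 1) {x y l m : ℂ} (hx : x ≠ 0) (hy : y ≠ 0)
    (hl : l ≠ 0) (hm : m ≠ 0) :
    theta q (x * l) * theta q (y * m) * theta q (l * m) * theta q (y / x) =
      theta q y * theta q l * theta q (x * l * m) * theta q (y * m / x) -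
        theta q x * theta q m * theta q (y * l * m) * theta q (x * l / y) := by
  by_cases hyl : theta q y * theta q l = 0
  · by_cases hxm : theta q x * theta q m = 0
    · by_cases hlm : theta q (y / x) * theta q (l * m) = 0
      · simp only [hyl, hxm, zero_mul, sub_zero]
        linear_combination theta q (x * l) * theta q (y * m) * hlm
      · have h := theta_fay_of_ne_zero hq0 hq (inv_ne_zero hm) (div_ne_zero hy hx)
          (mul_ne_zero hl hm) hx hlm
        rw [show m⁻¹ * (l * m) = l by field_simp, div_mul_cancel₀ y hx,
          show l * m * x = x * l * m by ring, show y / x / m⁻¹ = y * m / x by field_simp,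
          show l * x = x * l by ring, show y / m⁻¹ = y * m by field_simp, theta_inv,
          show y / x * (l * m) * x = y * l * m by field_simp,
          show l / (y / x) = x * l / y by field_simp] at h
        linear_combination -h
    · have h := theta_fay_of_ne_zero hq0 hq hy hx hm hl hxm
      rw [← inv_div, theta_inv, mul_comm m l, mul_right_comm x m, mul_right_comm y m] at h
      linear_combination -h
  · exact theta_fay_of_ne_zero hq0 hq hx hy hl hm hyl

end Theta

section Fay

variable {A K : Type*} [AddCommGroup A] [Field K]

/-- An odd function on a commutative group that satisfies the four-term theta identity of Fay. -/
structure IsFay (θ : A → K) : Prop where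
  neg (x : A) : θ (-x) = -θ x
  fay (x y l m : A) : θ (x + l) * θ (y + m) * θ (l + m) * θ (y - x) =
    θ y * θ l * θ (x + l + m) * θ (y + m - x) - θ x * θ m * θ (y + l + m) * θ (x + l - y)

namespace IsFay

variable {θ : A → K} {h : A}

theorem zero (hθ : IsFay θ) : θ 0 = 0 := by
  have := hθ.fay 0 0 0 0
  simpa using this

theorem sub_swap (hθ : IsFay θ) (x y : A) : θ (x - y) = -θ (y - x) := by
  rw [← hθ.neg, neg_sub]

theorem quadratic_relation (hθ : IsFay θ) (x m : A) :
    θ h ^ 2 * θ (x - m) * θ (x + m) + θ (h - x) * θ (h + x) * θ m ^ 2 =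
      θ x ^ 2 * θ (h + m) * θ (h - m) := by
  have h₁ := hθ.fay m h h (x - h)
  rw [hθ.sub_swap x h] at h₁
  abel_nf at h₁ ⊢
  linear_combination -h₁

theorem column_relation (hθ : IsFay θ) (u y₁ y₂ m : A) :
    θ (h + m) * θ (y₂ - y₁) * (θ (h + (y₁ - u)) * θ (y₂ - u + m)) =
      θ h * θ (y₂ - y₁ + m) * (θ (y₁ - u + (h + m)) * θ (y₂ - u)) -
        θ (h + (y₁ - y₂)) * θ m * (θ (y₂ - u + (h + m)) * θ (y₁ - u)) := by
  have h₁ := hθ.fay (y₁ - u) (y₂ - u) h m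
  abel_nf at h₁ ⊢
  linear_combination h₁

theorem minor_relation_fst (hθ : IsFay θ) (u v y₁ y₂ : A) :
    θ (y₂ - y₁) * θ (y₂ - v) * θ (h + (u - v)) * θ (h + (y₁ - u)) -
      θ (v - u) * θ (y₁ - u) * θ (h + (y₁ - y₂)) * θ (h + (y₂ - v)) =
    θ h * θ (h + (y₁ - v)) * θ (y₂ - u) * θ (y₂ - v - (y₁ - u)) := by
  have h₁ := hθ.fay (y₂ - u) (y₁ - u) (u - v) h
  rw [hθ.sub_swap u v, hθ.sub_swap (y₁ - u) (y₂ - u)] at h₁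
  abel_nf at h₁ ⊢
  linear_combination -h₁

theorem minor_relation_snd (hθ : IsFay θ) (u v y₁ y₂ M₁ M₂ : A) :
    θ (y₂ - y₁) * θ (y₁ - u + M₂) * θ (v - u + (M₁ - M₂)) * θ (y₂ - v + M₁) -
      θ (v - u) * θ (y₂ - v + M₂) * θ (y₂ - y₁ + (M₁ - M₂)) * θ (y₁ - u + M₁) =
    θ (M₁ - M₂) * θ (y₂ - u + M₁) * θ (y₁ - v + M₂) * θ (y₂ - v - (y₁ - u)) := by
  have h₁ := hθ.fay (y₁ - v + M₂) (y₂ - v + M₂) (v - u) (M₁ - M₂)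
  rw [hθ.sub_swap (y₁ - v + M₂ + (v - u)) (y₂ - v + M₂)] at h₁
  abel_nf at h₁ ⊢
  linear_combination h₁

theorem minor_relation (hθ : IsFay θ) (u v y₁ y₂ M₁ M₂ : A) :
    θ (y₂ - y₁) *
      (θ h * θ (v - u + (M₁ - M₂)) *
          (θ (y₁ - u + M₂) * θ (y₂ - u) * (θ (h + (y₁ - v)) * θ (y₂ - v + M₁))) -
        θ (M₁ - M₂) * θ (h + (u - v)) *
          (θ (y₁ - v + M₂) * θ (y₂ - v) * (θ (h + (y₁ - u)) * θ (y₂ - u + M₁)))) =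
    θ (v - u) *
      (θ h * θ (y₂ - y₁ + (M₁ - M₂)) *
          (θ (y₁ - u + M₁) * θ (y₂ - u) * (θ (h + (y₁ - v)) * θ (y₂ - v + M₂))) -
        θ (h + (y₁ - y₂)) * θ (M₁ - M₂) *
          (θ (y₂ - u + M₁) * θ (y₁ - u) * (θ (h + (y₂ - v)) * θ (y₁ - v + M₂)))) := by
  linear_combination
    θ h * θ (y₂ - u) * θ (h + (y₁ - v)) * hθ.minor_relation_snd u v y₁ y₂ M₁ M₂ -
      θ (M₁ - M₂) * θ (y₂ - u + M₁) * θ (y₁ - v + M₂) * hθ.minor_relation_fst (h := h) u v y₁ y₂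

end IsFay

end Fay

section Exchange

variable {A K : Type*} [AddCommGroup A]

/-- The factor `ψ` in terms of the times at which the elements appear: the root of level `k` with
label `a < k` belongs to the element `I a`, and that of level `k + 1` with label `c` to `I c`. -/
def entry (θ : A → K) (h : A) (I : Equiv.Perm ℕ) (μ : ℕ → A) (k a c : ℕ) (x : A) : K :=
  if I c < I a then θ (h + x)
  else if c = a then θ (x + ((if I k < I a then 0 else h) + μ k - μ a))
  else θ x

variable {θ : A → K} {h : A} {I : Equiv.Perm ℕ} {μ : ℕ → A} {k r r₁ r₂ : ℕ} {x y : ℕ → A}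

theorem swap_lt_iff_lt (hr₁ : r₁ < k) (hr₂ : r₂ < k) (a : ℕ) :
    Equiv.swap r₁ r₂ a < k ↔ a < k := by
  rw [Equiv.swap_apply_def]
  split_ifs <;> omega

theorem swap_eq_self_of_notMem {a : ℕ} (ha : a ∉ ({r₁, r₂} : Finset ℕ)) :
    Equiv.swap r₁ r₂ a = a := by
  simp only [mem_insert, mem_singleton, not_or] at ha
  exact Equiv.swap_apply_of_ne_of_ne ha.1 ha.2

theorem swap_mem_pair_iff (a : ℕ) :
    Equiv.swap r₁ r₂ a ∈ ({r₁, r₂} : Finset ℕ) ↔ a ∈ ({r₁, r₂} : Finset ℕ) := by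
  simp only [mem_insert, mem_singleton, Equiv.swap_apply_eq_iff, Equiv.swap_apply_left,
    Equiv.swap_apply_right, or_comm]

theorem swap_lt_swap_iff (hI : I r₂ = I r₁ + 1) {a b : ℕ}
    (hab : (a, b) ∉ ({r₁, r₂} : Finset ℕ) ×ˢ ({r₁, r₂} : Finset ℕ)) :
    I (Equiv.swap r₁ r₂ a) < I (Equiv.swap r₁ r₂ b) ↔ I a < I b := by
  have hne (c : ℕ) (hc : c ∉ ({r₁, r₂} : Finset ℕ)) : I c ≠ I r₁ ∧ I c ≠ I r₂ := by
    simp only [mem_insert, mem_singleton, not_or] at hc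
    exact ⟨I.injective.ne hc.1, I.injective.ne hc.2⟩
  have hval (c : ℕ) (hc : c ∈ ({r₁, r₂} : Finset ℕ)) :
      (I c = I r₁ ∨ I c = I r₂) ∧
        (I (Equiv.swap r₁ r₂ c) = I r₁ ∨ I (Equiv.swap r₁ r₂ c) = I r₂) := by
    simp only [mem_insert, mem_singleton] at hc
    rcases hc with rfl | rfl <;> simp
  simp only [mem_product, not_and_or] at hab
  by_cases ha : a ∈ ({r₁, r₂} : Finset ℕ)
  · have hb := hab.resolve_left (not_not.mpr ha)
    rw [swap_eq_self_of_notMem hb]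
    have := hne b hb
    have := hval a ha
    omega
  · rw [swap_eq_self_of_notMem ha]
    by_cases hb : b ∈ ({r₁, r₂} : Finset ℕ)
    · have := hne a ha
      have := hval b hb
      omega
    · rw [swap_eq_self_of_notMem hb]

theorem entry_mul_swap (hI : I r₂ = I r₁ + 1) {a c : ℕ}
    (hac : (a, c) ∉ ({r₁, r₂} : Finset ℕ) ×ˢ ({r₁, r₂} : Finset ℕ)) (u : A) :
    entry θ h (I * Equiv.swap r₁ r₂) μ k a c u = entry θ h I μ k a c u := by
  have hlt := swap_lt_swap_iff hI (a := c) (b := a) (by simpa [and_comm] using hac)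
  simp only [entry, Equiv.Perm.mul_apply, hlt]
  by_cases h : c = a
  · subst h
    have hlt' := swap_lt_swap_iff hI (a := k) (b := c) (by simp_all)
    simp only [hlt']
  · simp only [h, if_false]

theorem entry_swap_col (hI : I r₂ = I r₁ + 1) {a c : ℕ}
    (hac : (a, c) ∉ ({r₁, r₂} : Finset ℕ) ×ˢ ({r₁, r₂} : Finset ℕ)) (u : A) :
    entry θ h I μ k a (Equiv.swap r₁ r₂ c) u = entry θ h I μ k a c u := by
  by_cases hc : c ∈ ({r₁, r₂} : Finset ℕ)
  · have ha : a ∉ ({r₁, r₂} : Finset ℕ) := fun ha => hac (mem_product.mpr ⟨ha, hc⟩)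
    have hlt := swap_lt_swap_iff hI (a := c) (b := a) (by simpa [and_comm] using hac)
    rw [swap_eq_self_of_notMem ha] at hlt
    have hca : c ≠ a := fun h => ha (h ▸ hc)
    have hsca : Equiv.swap r₁ r₂ c ≠ a := fun h => ha (h ▸ (swap_mem_pair_iff c).mpr hc)
    simp only [entry, hlt, hca, hsca, if_false]
  · rw [swap_eq_self_of_notMem hc]

theorem entry_swap_row (hI : I r₂ = I r₁ + 1) {a c : ℕ}
    (hac : (a, c) ∉ ({r₁, r₂} : Finset ℕ) ×ˢ ({r₁, r₂} : Finset ℕ)) (u : A) :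
    entry θ h I μ k (Equiv.swap r₁ r₂ a) c u = entry θ h I μ k a c u := by
  by_cases ha : a ∈ ({r₁, r₂} : Finset ℕ)
  · have hc : c ∉ ({r₁, r₂} : Finset ℕ) := fun hc => hac (mem_product.mpr ⟨ha, hc⟩)
    have hlt := swap_lt_swap_iff hI (a := c) (b := a) (by simpa [and_comm] using hac)
    rw [swap_eq_self_of_notMem hc] at hlt
    have hca : c ≠ a := fun h => hc (h ▸ ha)
    have hcsa : c ≠ Equiv.swap r₁ r₂ a := fun h => hc (h ▸ (swap_mem_pair_iff a).mpr ha)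
    simp only [entry, hlt, hca, hcsa, if_false]
  · rw [swap_eq_self_of_notMem ha]

variable [Field K]

/-- The factor of the denominator attached to the roots with labels `a` and `b`. -/
def pairFactor (θ : A → K) (h : A) (I : Equiv.Perm ℕ) (x : ℕ → A) (a b : ℕ) : K :=
  if I a < I b then θ (h + (x a - x b)) * θ (x b - x a) else 1

/-- The factor of level `k` of the elliptic weight function. It depends only on the values of `x` on
`0, …, k - 1` and of `y` on `0, …, k`. -/
def kern (θ : A → K) (h : A) (I : Equiv.Perm ℕ) (μ : ℕ → A) (k : ℕ) (x y : ℕ → A) : K :=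
  (∏ p ∈ range k ×ˢ range (k + 1), entry θ h I μ k p.1 p.2 (y p.2 - x p.1)) /
    ∏ p ∈ range k ×ˢ range k, pairFactor θ h I x p.1 p.2

/-- The factor of level `k` without the contribution of the pairs of labels in `C`. -/
def kernRest (θ : A → K) (h : A) (I : Equiv.Perm ℕ) (μ : ℕ → A) (k : ℕ) (C : Finset ℕ)
    (x y : ℕ → A) : K :=
  (∏ p ∈ (range k ×ˢ range (k + 1)) \ (C ×ˢ C), entry θ h I μ k p.1 p.2 (y p.2 - x p.1)) /
    ∏ p ∈ (range k ×ˢ range k) \ (C ×ˢ C), pairFactor θ h I x p.1 p.2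

theorem kern_eq_mul_kernRest (C : Finset ℕ) :
    kern θ h I μ k x y =
      (∏ p ∈ (range k ∩ C) ×ˢ (range (k + 1) ∩ C), entry θ h I μ k p.1 p.2 (y p.2 - x p.1)) /
        (∏ p ∈ (range k ∩ C) ×ˢ (range k ∩ C), pairFactor θ h I x p.1 p.2) *
        kernRest θ h I μ k C x y := by
  rw [kern, kernRest, div_mul_div_comm, ← product_inter_product, ← product_inter_product,
    prod_inter_mul_prod_sdiff, prod_inter_mul_prod_sdiff]

theorem kern_eq_of_lt (hr₁ : r₁ < k) (hr₂ : r₂ < k) (hI : I r₂ = I r₁ + 1) {g : A}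
    (hg : g = if I k < I r₁ then 0 else h) :
    kern θ h I μ k x y =
      θ (y r₁ - x r₁ + (g + μ k - μ r₁)) * θ (y r₂ - x r₁) *
          (θ (h + (y r₁ - x r₂)) * θ (y r₂ - x r₂ + (g + μ k - μ r₂))) /
        (θ (h + (x r₁ - x r₂)) * θ (x r₂ - x r₁)) * kernRest θ h I μ k {r₁, r₂} x y := by
  have hr : r₁ ≠ r₂ := by
    rintro rfl
    omega
  have hk : I k ≠ I r₁ := I.injective.ne hr₁.ne'
  have hlt : I r₁ < I r₂ := by omega
  have hk₂ : I k < I r₂ ↔ I k < I r₁ := by omega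
  have hsub : {r₁, r₂} ⊆ range k := by simp [insert_subset_iff, hr₁, hr₂]
  rw [kern_eq_mul_kernRest {r₁, r₂}, inter_eq_right.mpr hsub,
    inter_eq_right.mpr (hsub.trans (range_subset_range.mpr k.le_succ))]
  simp only [prod_product, prod_pair hr, entry, pairFactor, lt_irrefl, hlt, hlt.not_gt, hr, hr.symm,
    hk₂, ← hg, if_true, if_false, mul_one, one_mul]

theorem kern_eq_of_last (hr : r < k) :
    kern θ h I μ k x y = entry θ h I μ k r r (y r - x r) * entry θ h I μ k r k (y k - x r) *
      kernRest θ h I μ k {r, k} x y := by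
  have hrange : range k ∩ {r, k} = {r} := by
    ext a
    simp only [mem_inter, mem_range, mem_insert, mem_singleton]
    omega
  have hrange' : range (k + 1) ∩ {r, k} = {r, k} := by
    refine inter_eq_right.mpr ?_
    simp [insert_subset_iff, hr.le]
  simp only [kern_eq_mul_kernRest {r, k}, hrange, hrange', prod_product, prod_singleton,
    prod_pair hr.ne, pairFactor, lt_irrefl, if_false, div_one]

theorem kernRest_mul_swap (hI : I r₂ = I r₁ + 1) :
    kernRest θ h (I * Equiv.swap r₁ r₂) μ k {r₁, r₂} x y = kernRest θ h I μ k {r₁, r₂} x y := by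
  unfold kernRest
  congr 1
  · exact prod_congr rfl fun p hp => entry_mul_swap hI (mem_sdiff.mp hp).2 _
  · refine prod_congr rfl fun p hp => ?_
    simp only [pairFactor, Equiv.Perm.mul_apply, swap_lt_swap_iff hI (mem_sdiff.mp hp).2]

theorem kernRest_swap_col (hI : I r₂ = I r₁ + 1) (hr₁ : r₁ ≤ k) (hr₂ : r₂ ≤ k) :
    kernRest θ h I μ k {r₁, r₂} x (y ∘ Equiv.swap r₁ r₂) = kernRest θ h I μ k {r₁, r₂} x y := by
  unfold kernRest
  congr 1
  refine prod_equiv ((Equiv.refl ℕ).prodCongr (Equiv.swap r₁ r₂)) (fun p => ?_) fun p hp => ?_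
  · simp only [mem_sdiff, mem_product, mem_range, Equiv.prodCongr_apply, Prod.map, Equiv.refl_apply,
      swap_lt_iff_lt (Nat.lt_succ_of_le hr₁) (Nat.lt_succ_of_le hr₂), swap_mem_pair_iff]
  · exact (entry_swap_col hI (mem_sdiff.mp hp).2 _).symm

theorem kernRest_swap_row (hI : I r₂ = I r₁ + 1) (hr₁ : r₁ < k) (hr₂ : r₂ < k) :
    kernRest θ h I μ k {r₁, r₂} (x ∘ Equiv.swap r₁ r₂) y = kernRest θ h I μ k {r₁, r₂} x y := by
  unfold kernRest
  congr 1
  · refine prod_equiv ((Equiv.swap r₁ r₂).prodCongr (Equiv.refl ℕ)) (fun p => ?_) fun p hp => ?_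
    · simp only [mem_sdiff, mem_product, mem_range, Equiv.prodCongr_apply, Prod.map,
        Equiv.refl_apply, swap_lt_iff_lt hr₁ hr₂, swap_mem_pair_iff]
    · exact (entry_swap_row hI (mem_sdiff.mp hp).2 _).symm
  · refine prod_equiv ((Equiv.swap r₁ r₂).prodCongr (Equiv.swap r₁ r₂)) (fun p => ?_) fun p hp => ?_
    · simp only [mem_sdiff, mem_product, mem_range, Equiv.prodCongr_apply, Prod.map,
        swap_lt_iff_lt hr₁ hr₂, swap_mem_pair_iff]
    · simp only [pairFactor, Function.comp_apply, Equiv.prodCongr_apply, Prod.map,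
        swap_lt_swap_iff hI (mem_sdiff.mp hp).2]

theorem IsFay.kern_exchange (hθ : IsFay θ) (hr₁ : r₁ < k) (hr₂ : r₂ < k) (hI : I r₂ = I r₁ + 1)
    (hx₁ : θ (h + (x r₁ - x r₂)) ≠ 0) (hx₂ : θ (h + (x r₂ - x r₁)) ≠ 0)
    (hx : θ (x r₂ - x r₁) ≠ 0) :
    θ (y r₂ - y r₁) *
      (θ h * θ (x r₂ - x r₁ + (μ r₂ - μ r₁)) / θ (x r₂ - x r₁) *
          kern θ h (I * Equiv.swap r₁ r₂) μ k (x ∘ Equiv.swap r₁ r₂) (y ∘ Equiv.swap r₁ r₂) -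
        θ (h + (x r₂ - x r₁)) * θ (μ r₂ - μ r₁) / θ (x r₁ - x r₂) *
          kern θ h (I * Equiv.swap r₁ r₂) μ k x (y ∘ Equiv.swap r₁ r₂)) =
    θ h * θ (y r₂ - y r₁ + (μ r₂ - μ r₁)) * kern θ h I μ k x y -
      θ (h + (y r₁ - y r₂)) * θ (μ r₂ - μ r₁) * kern θ h I μ k x (y ∘ Equiv.swap r₁ r₂) := by
  obtain ⟨g, hg⟩ : ∃ g, g = if I k < I r₁ then 0 else h := ⟨_, rfl⟩
  have hIs : (I * Equiv.swap r₁ r₂) r₁ = (I * Equiv.swap r₁ r₂) r₂ + 1 := by simpa using hI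
  have hk : Equiv.swap r₁ r₂ k = k := Equiv.swap_apply_of_ne_of_ne hr₁.ne' hr₂.ne'
  have hgs : g = if (I * Equiv.swap r₁ r₂) k < (I * Equiv.swap r₁ r₂) r₂ then 0 else h := by
    simpa [hk] using hg
  have hrel := hθ.minor_relation (h := h) (x r₁) (x r₂) (y r₁) (y r₂) (g + μ k - μ r₁)
    (g + μ k - μ r₂)
  rw [sub_sub_sub_cancel_left] at hrel
  simp only [kern_eq_of_lt hr₁ hr₂ hI hg, kern_eq_of_lt hr₂ hr₁ hIs hgs, pair_comm r₂ r₁,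
    kernRest_mul_swap hI, kernRest_swap_row hI hr₁ hr₂, kernRest_swap_col hI hr₁.le hr₂.le,
    Function.comp_apply, Equiv.swap_apply_left, Equiv.swap_apply_right, hθ.sub_swap (x r₁) (x r₂)]
  field_simp
  linear_combination kernRest θ h I μ k {r₁, r₂} x y * hrel

theorem IsFay.kern_exchange_last (hθ : IsFay θ) (hr : r < k) (hI : I k = I r + 1) :
    θ (h + (μ k - μ r)) * θ (y k - y r) *
        kern θ h (I * Equiv.swap r k) μ k x (y ∘ Equiv.swap r k) =
    θ h * θ (y k - y r + (μ k - μ r)) * kern θ h I μ k x y -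
      θ (h + (y r - y k)) * θ (μ k - μ r) * kern θ h I μ k x (y ∘ Equiv.swap r k) := by
  have hlt : I r < I k := by omega
  simp only [kern_eq_of_last hr, kernRest_mul_swap hI, kernRest_swap_col hI hr.le le_rfl]
  simp only [entry, Equiv.Perm.mul_apply, Function.comp_apply, Equiv.swap_apply_left,
    Equiv.swap_apply_right, lt_irrefl, hlt, hlt.not_gt, hr.ne', if_true, if_false, zero_add,
    add_sub_assoc]
  linear_combination
    kernRest θ h I μ k {r, k} x y * hθ.column_relation (h := h) (x r) (y r) (y k) (μ k - μ r)

end Exchange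

section PartialWeight

/-- The extension of a permutation of `Fin k` to the natural numbers by the identity. -/
def extendPerm {k : ℕ} : Equiv.Perm (Fin k) →* Equiv.Perm ℕ :=
  Equiv.Perm.viaEmbeddingHom Fin.valEmbedding

@[simp]
theorem extendPerm_val {k : ℕ} (σ : Equiv.Perm (Fin k)) (a : Fin k) : extendPerm σ a = σ a :=
  Equiv.Perm.viaEmbedding_apply σ Fin.valEmbedding a

theorem extendPerm_of_le {k a : ℕ} (σ : Equiv.Perm (Fin k)) (ha : k ≤ a) : extendPerm σ a = a :=
  Equiv.Perm.viaEmbedding_apply_of_notMem σ Fin.valEmbedding a (by simpa using ha)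

theorem extendPerm_swap {k : ℕ} (r₁ r₂ : Fin k) :
    extendPerm (Equiv.swap r₁ r₂) = Equiv.swap (r₁ : ℕ) r₂ := by
  ext a
  obtain ha | ha := lt_or_ge a k
  · lift a to Fin k using ha
    rw [extendPerm_val, ← Fin.val_injective.swap_apply]
  · rw [extendPerm_of_le _ ha, Equiv.swap_apply_of_ne_of_ne] <;> omega

theorem sum_comp_extendPerm_swap {α M : Type*} [AddCommMonoid M] {k r₁ r₂ : ℕ} (hr₁ : r₁ < k)
    (hr₂ : r₂ < k) (w : ℕ → α) (f : (ℕ → α) → M) :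
    ∑ τ : Equiv.Perm (Fin k), f ((w ∘ extendPerm τ) ∘ Equiv.swap r₁ r₂) =
      ∑ τ : Equiv.Perm (Fin k), f (w ∘ extendPerm τ) := by
  lift r₁ to Fin k using hr₁
  lift r₂ to Fin k using hr₂
  refine Fintype.sum_equiv (Equiv.mulRight (Equiv.swap r₁ r₂)) _ _ fun τ => ?_
  rw [Equiv.coe_mulRight, map_mul, extendPerm_swap, Equiv.Perm.coe_mul, Function.comp_assoc]

theorem sum_range_extendPerm {M : Type*} [AddCommMonoid M] {k : ℕ} (σ : Equiv.Perm (Fin k))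
    (f : ℕ → M) : ∑ a ∈ range k, f (extendPerm σ a) = ∑ a ∈ range k, f a := by
  simp only [sum_range, extendPerm_val]
  exact Equiv.sum_comp σ fun a => f a

variable {A K : Type*} [AddCommGroup A] [Field K]

/-- The points `w i` are distinct and stay so after a shift by `h`, as measured by the zeros of `θ`;
then no denominator of the weight functions vanishes. -/
def IsGeneric {ι : Type*} (θ : A → K) (h : A) (w : ι → A) : Prop :=
  Pairwise fun i j => θ (w i - w j) ≠ 0 ∧ θ (h + (w i - w j)) ≠ 0

theorem IsGeneric.comp {ι ι' : Type*} {θ : A → K} {h : A} {w : ι → A} (hw : IsGeneric θ h w)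
    {f : ι' → ι} (hf : Function.Injective f) : IsGeneric θ h (w ∘ f) :=
  hw.comp_of_injective hf

/-- The partial elliptic weight function of level `k`, restricted to a fixed point: the roots of
each level `j < k` are `w 0, …, w (j - 1)` in any order, and those of level `k` are
`y 0, …, y (k - 1)`. -/
def partialWeight (θ : A → K) (h : A) (I : Equiv.Perm ℕ) (μ w : ℕ → A) : ℕ → (ℕ → A) → K
  | 0, _ => 1
  | k + 1, y => ∑ τ : Equiv.Perm (Fin k),
      partialWeight θ h I μ w k (w ∘ extendPerm τ) * kern θ h I μ k (w ∘ extendPerm τ) y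

variable {θ : A → K} {h : A} {I : Equiv.Perm ℕ} {μ w : ℕ → A} {k r₁ r₂ : ℕ}

theorem kern_congr {I' : Equiv.Perm ℕ} {x x' y y' : ℕ → A}
    (hI : ∀ a ≤ k, ∀ b ≤ k, (I a < I b ↔ I' a < I' b)) (hx : ∀ a < k, x a = x' a)
    (hy : ∀ a ≤ k, y a = y' a) : kern θ h I μ k x y = kern θ h I' μ k x' y' := by
  unfold kern
  congr 1
  · refine prod_congr rfl fun p hp => ?_
    simp only [mem_product, mem_range, Nat.lt_succ_iff] at hp
    simp only [entry, hI _ hp.2 _ hp.1.le, hI k le_rfl _ hp.1.le, hx _ hp.1, hy _ hp.2]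
  · refine prod_congr rfl fun p hp => ?_
    simp only [mem_product, mem_range] at hp
    simp only [pairFactor, hI _ hp.1.le _ hp.2.le, hx _ hp.1, hx _ hp.2]

theorem partialWeight_congr {I' : Equiv.Perm ℕ} {y y' : ℕ → A}
    (hI : ∀ a < k, ∀ b < k, (I a < I b ↔ I' a < I' b)) (hy : ∀ a < k, y a = y' a) :
    partialWeight θ h I μ w k y = partialWeight θ h I' μ w k y' := by
  induction k generalizing y y' with
  | zero => rfl
  | succ k ih =>
    refine sum_congr rfl fun τ _ => congrArg₂ (· * ·) ?_ ?_
    · exact ih (fun a ha b hb => hI a (ha.trans k.lt_succ_self) b (hb.trans k.lt_succ_self))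
        fun _ _ => rfl
    · exact kern_congr
        (fun a ha b hb => hI a (Nat.lt_succ_of_le ha) b (Nat.lt_succ_of_le hb))
        (fun _ _ => rfl) fun a ha => hy a (Nat.lt_succ_of_le ha)

theorem IsGeneric.comp_extendPerm (hw : IsGeneric θ h fun i : Fin k => w i)
    (τ : Equiv.Perm (Fin k)) (hr₁ : r₁ < k) (hr₂ : r₂ < k) (hr : r₁ ≠ r₂) :
    θ ((w ∘ extendPerm τ) r₁ - (w ∘ extendPerm τ) r₂) ≠ 0 ∧
      θ (h + ((w ∘ extendPerm τ) r₁ - (w ∘ extendPerm τ) r₂)) ≠ 0 := by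
  lift r₁ to Fin k using hr₁
  lift r₂ to Fin k using hr₂
  simp only [Function.comp_apply, extendPerm_val]
  exact hw (τ.injective.ne fun h => hr (congrArg Fin.val h))

theorem mul_sum_mul_of_exchange {R α : Type*} [CommRing R] (hr₁ : r₁ < k) (hr₂ : r₂ < k)
    {w : ℕ → α} {c : R} {F G P P' : (ℕ → α) → R}
    (hP : ∀ τ : Equiv.Perm (Fin k), c * P' ((w ∘ extendPerm τ) ∘ Equiv.swap r₁ r₂) =
      F (w ∘ extendPerm τ) * P (w ∘ extendPerm τ) -
        G (w ∘ extendPerm τ) * P ((w ∘ extendPerm τ) ∘ Equiv.swap r₁ r₂)) (Q : (ℕ → α) → R) :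
    c * ∑ τ : Equiv.Perm (Fin k), P' (w ∘ extendPerm τ) * Q (w ∘ extendPerm τ) =
      ∑ τ : Equiv.Perm (Fin k), P (w ∘ extendPerm τ) *
        (F (w ∘ extendPerm τ) * Q ((w ∘ extendPerm τ) ∘ Equiv.swap r₁ r₂) -
          G ((w ∘ extendPerm τ) ∘ Equiv.swap r₁ r₂) * Q (w ∘ extendPerm τ)) := by
  set s := Equiv.swap r₁ r₂ with hs
  have hss (x : ℕ → α) : (x ∘ s) ∘ s = x := by
    rw [Function.comp_assoc, ← Equiv.Perm.coe_mul, hs, Equiv.swap_mul_self, Equiv.Perm.coe_one,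
      Function.comp_id]
  calc
    _ = ∑ τ : Equiv.Perm (Fin k), c * P' ((w ∘ extendPerm τ) ∘ s) * Q ((w ∘ extendPerm τ) ∘ s) := by
      rw [sum_comp_extendPerm_swap hr₁ hr₂ w fun x => c * P' x * Q x]
      simp only [mul_assoc, mul_sum]
    _ = ∑ τ : Equiv.Perm (Fin k),
            P (w ∘ extendPerm τ) * (F (w ∘ extendPerm τ) * Q ((w ∘ extendPerm τ) ∘ s)) -
          ∑ τ : Equiv.Perm (Fin k), P ((w ∘ extendPerm τ) ∘ s) *
            (G (((w ∘ extendPerm τ) ∘ s) ∘ s) * Q ((w ∘ extendPerm τ) ∘ s)) := by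
      rw [← sum_sub_distrib]
      refine sum_congr rfl fun τ _ => ?_
      rw [hP, hss]
      ring
    _ = _ := by
      rw [sum_comp_extendPerm_swap hr₁ hr₂ w fun x => P x * (G (x ∘ s) * Q x), ← sum_sub_distrib]
      exact sum_congr rfl fun τ _ => (mul_sub _ _ _).symm

/-- The exchange relation passes from level `k` to level `k + 1`: symmetrizing over `τ` moves the
swap of `r₁` and `r₂` from the partial weight functions to the kernels. -/
theorem IsFay.sum_exchange (hθ : IsFay θ) (hr₁ : r₁ < k) (hr₂ : r₂ < k) (hI : I r₂ = I r₁ + 1)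
    (hw : IsGeneric θ h fun i : Fin k => w i) {P P' : (ℕ → A) → K}
    (hP : ∀ x, θ (h + (μ r₂ - μ r₁)) * θ (x r₂ - x r₁) * P' (x ∘ Equiv.swap r₁ r₂) =
      θ h * θ (x r₂ - x r₁ + (μ r₂ - μ r₁)) * P x -
        θ (h + (x r₁ - x r₂)) * θ (μ r₂ - μ r₁) * P (x ∘ Equiv.swap r₁ r₂)) (y : ℕ → A) :
    θ (h + (μ r₂ - μ r₁)) * θ (y r₂ - y r₁) *
        ∑ τ : Equiv.Perm (Fin k), P' (w ∘ extendPerm τ) *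
          kern θ h (I * Equiv.swap r₁ r₂) μ k (w ∘ extendPerm τ) (y ∘ Equiv.swap r₁ r₂) =
      θ h * θ (y r₂ - y r₁ + (μ r₂ - μ r₁)) *
          ∑ τ : Equiv.Perm (Fin k), P (w ∘ extendPerm τ) * kern θ h I μ k (w ∘ extendPerm τ) y -
        θ (h + (y r₁ - y r₂)) * θ (μ r₂ - μ r₁) *
          ∑ τ : Equiv.Perm (Fin k), P (w ∘ extendPerm τ) *
            kern θ h I μ k (w ∘ extendPerm τ) (y ∘ Equiv.swap r₁ r₂) := by
  have hr : r₁ ≠ r₂ := by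
    rintro rfl
    omega
  have hsum := mul_sum_mul_of_exchange hr₁ hr₂ (w := w) (c := θ (h + (μ r₂ - μ r₁)))
    (F := fun x => θ h * θ (x r₂ - x r₁ + (μ r₂ - μ r₁)) / θ (x r₂ - x r₁))
    (G := fun x => θ (h + (x r₁ - x r₂)) * θ (μ r₂ - μ r₁) / θ (x r₂ - x r₁)) (P := P) (P' := P')
    (fun τ => by
      have := (hw.comp_extendPerm τ hr₂ hr₁ hr.symm).1
      field_simp
      linear_combination hP (w ∘ extendPerm τ))
    fun x => kern θ h (I * Equiv.swap r₁ r₂) μ k x (y ∘ Equiv.swap r₁ r₂)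
  rw [mul_right_comm, hsum, mul_comm, mul_sum, mul_sum, mul_sum, ← sum_sub_distrib]
  refine sum_congr rfl fun τ _ => ?_
  have hker := hθ.kern_exchange hr₁ hr₂ hI (μ := μ) (y := y)
    (hw.comp_extendPerm τ hr₁ hr₂ hr).2 (hw.comp_extendPerm τ hr₂ hr₁ hr.symm).2
    (hw.comp_extendPerm τ hr₂ hr₁ hr.symm).1
  simp only [Function.comp_apply, Equiv.swap_apply_left, Equiv.swap_apply_right] at hker ⊢
  linear_combination P (w ∘ extendPerm τ) * hker

theorem IsFay.partialWeight_exchange (hθ : IsFay θ) (hr : r₁ < r₂) (hr₂ : r₂ < k)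
    (hI : I r₂ = I r₁ + 1) (hw : IsGeneric θ h fun i : Fin k => w i) (y : ℕ → A) :
    θ (h + (μ r₂ - μ r₁)) * θ (y r₂ - y r₁) *
        partialWeight θ h (I * Equiv.swap r₁ r₂) μ w k (y ∘ Equiv.swap r₁ r₂) =
      θ h * θ (y r₂ - y r₁ + (μ r₂ - μ r₁)) * partialWeight θ h I μ w k y -
        θ (h + (y r₁ - y r₂)) * θ (μ r₂ - μ r₁) *
          partialWeight θ h I μ w k (y ∘ Equiv.swap r₁ r₂) := by
  induction k generalizing y with
  | zero => omega
  | succ k ih =>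
    have hwk : IsGeneric θ h fun i : Fin k => w i := hw.comp (Fin.castSucc_injective k)
    obtain hr₂k | rfl := (Nat.lt_succ_iff.mp hr₂).lt_or_eq
    · exact hθ.sum_exchange (hr.trans hr₂k) hr₂k hI hwk (ih hr₂k hwk) y
    · have hcongr (x : ℕ → A) : partialWeight θ h (I * Equiv.swap r₁ r₂) μ w r₂ x =
          partialWeight θ h I μ w r₂ x := by
        refine partialWeight_congr (fun a ha b hb => ?_) fun _ _ => rfl
        obtain rfl | hab := eq_or_ne a b
        · simp only [lt_irrefl]
        · refine swap_lt_swap_iff hI ?_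
          simp only [mem_product, mem_insert, mem_singleton]
          omega
      simp only [partialWeight, hcongr, mul_sum, ← sum_sub_distrib]
      refine sum_congr rfl fun τ _ => ?_
      linear_combination partialWeight θ h I μ w r₂ (w ∘ extendPerm τ) *
        hθ.kern_exchange_last (h := h) (μ := μ) (x := w ∘ extendPerm τ) (y := y) hr hI

end PartialWeight

section Support

variable {A K : Type*} [AddCommGroup A] [Field K] {θ : A → K} {h : A}
  {I J : Equiv.Perm ℕ} {μ w Z : ℕ → A} {k : ℕ}

theorem IsFay.kern_eq_zero (hθ : IsFay θ) {x y : ℕ → A} {a c : ℕ} (ha : a < k) (hc : c ≤ k)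
    (hlt : I a < I c) (hxy : y c = x a) : kern θ h I μ k x y = 0 := by
  have hca : c ≠ a := by
    rintro rfl
    exact lt_irrefl _ hlt
  have hentry : entry θ h I μ k a c (y c - x a) = 0 := by
    rw [entry, if_neg hlt.not_gt, if_neg hca, hxy, sub_self, hθ.zero]
  have hmem : (a, c) ∈ range k ×ˢ range (k + 1) :=
    mk_mem_product (mem_range.mpr ha) (mem_range.mpr (Nat.lt_succ_of_le hc))
  rw [kern, prod_eq_zero hmem hentry, zero_div]

theorem IsFay.eq_of_kern_ne_zero (hθ : IsFay θ)
    (himage : (range (k + 1)).image I = (range (k + 1)).image J) (hk : J k ≤ I k)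
    {τ : Equiv.Perm (Fin k)}
    (hne : kern θ h I μ k ((Z ∘ J) ∘ extendPerm τ) (Z ∘ I) ≠ 0) {a : ℕ} (ha : a ≤ k) :
    J (extendPerm τ a) = I a := by
  have hle (a : ℕ) (ha : a ∈ range (k + 1)) : J (extendPerm τ a) ≤ I a := by
    obtain hak | rfl := (Nat.lt_succ_iff.mp (mem_range.mp ha)).lt_or_eq
    · by_contra! hlt
      have hmem : J (extendPerm τ a) ∈ (range (k + 1)).image J := by
        refine mem_image_of_mem _ (mem_range.mpr ?_)
        lift a to Fin k using hak
        rw [extendPerm_val]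
        omega
      obtain ⟨c, hc, hcJ⟩ := mem_image.mp (himage ▸ hmem)
      exact hne (hθ.kern_eq_zero hak (Nat.lt_succ_iff.mp (mem_range.mp hc)) (hcJ ▸ hlt)
        (congrArg Z hcJ))
    · rwa [extendPerm_of_le τ le_rfl]
  have hsum : ∑ m ∈ range (k + 1), J (extendPerm τ m) = ∑ m ∈ range (k + 1), I m := by
    rw [← sum_image (f := fun m => m) I.injective.injOn, himage,
      sum_image (f := fun m => m) J.injective.injOn, sum_range_succ, sum_range_succ,
      extendPerm_of_le τ le_rfl, sum_range_extendPerm τ J]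
  exact (sum_eq_sum_iff_of_le hle).mp hsum a (mem_range.mpr (Nat.lt_succ_of_le ha))

theorem IsFay.eq_of_partialWeight_ne_zero (hθ : IsFay θ)
    (himage : (range k).image I = (range k).image J)
    (hJI : ∀ m < k, (range (m + 1)).image I = (range (m + 1)).image J → J m ≤ I m)
    (hne : partialWeight θ h I μ (Z ∘ J) k (Z ∘ I) ≠ 0) : ∀ m < k, I m = J m := by
  induction k with
  | zero => simp only [not_lt_zero, IsEmpty.forall_iff, implies_true]
  | succ k ih =>
    obtain ⟨τ, -, hτ⟩ := exists_ne_zero_of_sum_ne_zero hne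
    have heq (a : ℕ) (ha : a ≤ k) : J (extendPerm τ a) = I a :=
      hθ.eq_of_kern_ne_zero himage (hJI k k.lt_succ_self himage) (right_ne_zero_of_mul hτ) ha
    have hlast : J k = I k := by simpa only [extendPerm_of_le τ le_rfl] using heq k le_rfl
    have himage' : (range k).image I = (range k).image J := by
      rw [range_add_one, image_insert, image_insert, hlast] at himage
      have hnI : I k ∉ (range k).image I := by simp
      have hnJ : I k ∉ (range k).image J := by simp [← hlast]
      rw [← erase_insert hnI, himage, erase_insert hnJ]
    have hneI : partialWeight θ h I μ (Z ∘ J) k (Z ∘ I) ≠ 0 := by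
      convert! left_ne_zero_of_mul hτ using 1
      exact partialWeight_congr (fun _ _ _ _ => Iff.rfl) fun a ha => congrArg Z (heq a ha.le).symm
    intro m hm
    obtain hmk | rfl := (Nat.lt_succ_iff.mp hm).lt_or_eq
    · exact ih himage' (fun m hm => hJI m (hm.trans k.lt_succ_self)) hneI m hmk
    · exact hlast.symm

theorem IsFay.partialWeight_self (hθ : IsFay θ) :
    partialWeight θ h I μ (Z ∘ I) k (Z ∘ I) =
      ∏ m ∈ range k, kern θ h I μ m (Z ∘ I) (Z ∘ I) := by
  induction k with
  | zero => rfl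
  | succ k ih =>
    rw [partialWeight, prod_range_succ, ← ih, sum_eq_single 1]
    · rw [map_one, Equiv.Perm.coe_one, Function.comp_id]
    · intro τ _ hτ
      by_contra hne
      refine hτ (Equiv.ext fun a => Fin.ext (I.injective ?_))
      rw [← extendPerm_val]
      exact hθ.eq_of_kern_ne_zero rfl le_rfl (right_ne_zero_of_mul hne) a.2.le
    · simp only [mem_univ, not_true_eq_false, IsEmpty.forall_iff]

theorem prod_pairFactor_eq :
    ∏ p ∈ range k ×ˢ range k, pairFactor θ h I w p.1 p.2 =
      ∏ a ∈ range k, ∏ b ∈ (range k).erase a, entry θ h I μ k a b (w b - w a) := by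
  have hentry (a : ℕ) (ha : a ∈ range k) :
      ∏ b ∈ (range k).erase a, entry θ h I μ k a b (w b - w a) =
        ∏ b ∈ range k, (if I b < I a then θ (h + (w b - w a)) else 1) *
          if I a < I b then θ (w b - w a) else 1 := by
    rw [← mul_prod_erase (range k) _ ha]
    simp only [lt_irrefl, if_false, one_mul]
    refine prod_congr rfl fun b hb => ?_
    have hne : b ≠ a := ne_of_mem_erase hb
    have hI : I b ≠ I a := I.injective.ne hne
    rw [entry]
    split_ifs <;> first | omega | simp only [mul_one, one_mul]
  rw [prod_congr rfl hentry, prod_product]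
  simp only [prod_mul_distrib]
  rw [prod_comm (f := fun a b => if I b < I a then θ (h + (w b - w a)) else 1)]
  simp only [← prod_mul_distrib]
  refine prod_congr rfl fun a _ => prod_congr rfl fun b _ => ?_
  rw [pairFactor]
  split_ifs
  · rfl
  · rw [one_mul]

theorem kern_self (hw : IsGeneric θ h fun i : Fin k => w i) :
    kern θ h I μ k w w =
      ∏ a ∈ range k, if I k < I a then θ (μ k - μ a) * θ (h + (w k - w a))
        else θ (h + (μ k - μ a)) * θ (w k - w a) := by
  have hne : ∏ p ∈ range k ×ˢ range k, pairFactor θ h I w p.1 p.2 ≠ 0 := by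
    refine prod_ne_zero_iff.mpr fun p hp => ?_
    obtain ⟨h₁, h₂⟩ := mem_product.mp hp
    rw [pairFactor]
    split_ifs with hlt
    · have hne : p.1 ≠ p.2 := fun h => lt_irrefl _ (h ▸ hlt)
      exact mul_ne_zero
        (hw (i := ⟨p.1, mem_range.mp h₁⟩) (j := ⟨p.2, mem_range.mp h₂⟩) (by simpa using hne)).2
        (hw (i := ⟨p.2, mem_range.mp h₂⟩) (j := ⟨p.1, mem_range.mp h₁⟩) (by simpa using hne.symm)).1
    · exact one_ne_zero
  rw [kern, div_eq_iff hne, prod_pairFactor_eq (μ := μ), prod_product, ← prod_mul_distrib]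
  refine prod_congr rfl fun a ha => ?_
  rw [prod_range_succ, ← mul_prod_erase (range k) _ ha]
  simp only [entry, lt_irrefl, if_false, if_true, (mem_range.mp ha).ne', sub_self, zero_add]
  split_ifs <;> (simp only [zero_add, add_sub_assoc]; ring)

end Support

section FixedWeight

variable {A K : Type*} [AddCommGroup A] [Field K] {n : ℕ}

/-- The extension of a family of parameters to the natural numbers by zero. -/
def extendParam (z : Fin n → A) : ℕ → A := Function.extend Fin.val z 0

@[simp]
theorem extendParam_val (z : Fin n → A) (i : Fin n) : extendParam z i = z i :=
  Fin.val_injective.extend_apply z 0 i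

theorem extendParam_comp (z : Fin n → A) (σ : Equiv.Perm (Fin n)) :
    extendParam (z ∘ σ) = extendParam z ∘ extendPerm σ := by
  funext m
  obtain hm | hm := lt_or_ge m n
  · lift m to Fin n using hm
    simp only [extendParam_val, extendPerm_val, Function.comp_apply]
  · rw [Function.comp_apply, extendPerm_of_le σ hm, extendParam, extendParam,
      Function.extend_apply', Function.extend_apply'] <;> rintro ⟨a, rfl⟩ <;> omega

/-- The restriction matrix, computed with the Chern roots labelled by the times at which their
elements appear. -/
def fixedWeight (θ : A → K) (h : A) (I J : Equiv.Perm (Fin n)) (z μ : Fin n → A) : K :=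
  partialWeight θ h (extendPerm I) (extendParam μ) (extendParam z ∘ extendPerm J) n
    (extendParam z ∘ extendPerm I)

variable {θ : A → K} {h : A} {I J : Equiv.Perm (Fin n)} {z μ : Fin n → A}

theorem image_extendPerm_range (σ : Equiv.Perm (Fin n)) :
    (range n).image (extendPerm σ) = range n := by
  refine eq_of_subset_of_card_le (image_subset_iff.mpr fun m hm => ?_) ?_
  · lift m to Fin n using mem_range.mp hm
    rw [extendPerm_val]
    exact mem_range.mpr (σ m).2
  · rw [card_image_of_injective _ (extendPerm σ).injective]

theorem IsFay.fixedWeight_eq_zero (hθ : IsFay θ) (hIJ : I ≠ J) (hJI : I = 1 ∨ J = Fin.revPerm) :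
    fixedWeight θ h I J z μ = 0 := by
  by_contra hne
  refine hIJ (Equiv.ext fun m => Fin.ext ?_)
  rw [← extendPerm_val, ← extendPerm_val]
  refine hθ.eq_of_partialWeight_ne_zero ?_ (fun m hm himage => ?_) hne m m.2
  · rw [image_extendPerm_range, image_extendPerm_range]
  rcases hJI with rfl | rfl
  · have hmem := mem_image_of_mem (extendPerm J) (self_mem_range_succ m)
    rw [← himage, map_one, Equiv.Perm.coe_one, image_id] at hmem
    simpa [Nat.lt_succ_iff] using hmem
  · have hmem := mem_image_of_mem (extendPerm I) (self_mem_range_succ m)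
    rw [himage] at hmem
    obtain ⟨a, ha, haI⟩ := mem_image.mp hmem
    have ham := mem_range.mp ha
    rw [← haI]
    lift m to Fin n using hm
    lift a to Fin n using by omega
    simp only [extendPerm_val, Fin.revPerm_apply, Fin.val_rev]
    omega

theorem IsFay.fixedWeight_self (hθ : IsFay θ) (hz : IsGeneric θ h z) :
    fixedWeight θ h I I z μ = ∏ k : Fin n, ∏ a ∈ Iio k,
      if I k < I a then θ (μ k - μ a) * θ (h + (z (I k) - z (I a)))
        else θ (h + (μ k - μ a)) * θ (z (I k) - z (I a)) := by
  rw [fixedWeight, hθ.partialWeight_self, prod_range]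
  refine prod_congr rfl fun k _ => ?_
  rw [kern_self, ← Nat.Iio_eq_range, ← Fin.map_valEmbedding_Iio, prod_map]
  · simp only [Fin.valEmbedding_apply, extendPerm_val, extendParam_val, Function.comp_apply,
      Fin.lt_def]
  · convert! hz.comp (I.injective.comp (Fin.castLE_injective k.2.le)) using 1
    funext i
    exact (congrFun (extendParam_comp z I).symm _).trans (extendParam_val _ (Fin.castLE k.2.le i))

end FixedWeight

section Recursion

variable {n : ℕ}

theorem comp_swap_comp_swap_mul {α : Type*} (z : Fin n → α) (a b : Fin n) (J : Equiv.Perm (Fin n)) :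
    (z ∘ Equiv.swap a b) ∘ ⇑(Equiv.swap a b * J) = z ∘ J := by
  funext i
  simp only [Function.comp_apply, Equiv.Perm.mul_apply, Equiv.swap_apply_self]

variable {A K : Type*} [AddCommGroup A] [Field K] {θ : A → K} {h : A} {z μ : Fin n → A}
  {F G : Equiv.Perm (Fin n) → Equiv.Perm (Fin n) → (Fin n → A) → K}

theorem IsGeneric.neg (hz : IsGeneric θ h z) : IsGeneric θ h (-z) := by
  intro i j hij
  simp only [Pi.neg_apply, neg_sub_neg]
  exact hz hij.symm

/-- The relation between the rows `I` and `swap a b * I` of the restriction matrix, for adjacent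
`a` and `b`. With the dynamical parameters `μ` fixed, it determines all rows from the row `1`. -/
def SatisfiesExchange (θ : A → K) (h : A) (μ : Fin n → A)
    (F : Equiv.Perm (Fin n) → Equiv.Perm (Fin n) → (Fin n → A) → K) : Prop :=
  ∀ ⦃z⦄, IsGeneric θ h z → ∀ ⦃a b : Fin n⦄, (b : ℕ) = a + 1 → ∀ I J,
    θ (h + (μ (I⁻¹ b) - μ (I⁻¹ a))) * θ (z b - z a) * F (Equiv.swap a b * I) J z =
      θ h * θ (z b - z a + (μ (I⁻¹ b) - μ (I⁻¹ a))) * F I J z -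
        θ (h + (z a - z b)) * θ (μ (I⁻¹ b) - μ (I⁻¹ a)) *
          F I (Equiv.swap a b * J) (z ∘ Equiv.swap a b)

namespace SatisfiesExchange

theorem sub (hF : SatisfiesExchange θ h μ F) (hG : SatisfiesExchange θ h μ G) :
    SatisfiesExchange θ h μ (F - G) := by
  intro z hz a b hab I J
  simp only [Pi.sub_apply]
  linear_combination hF hz hab I J - hG hz hab I J

theorem mul_comp (hF : SatisfiesExchange θ h μ F) (g : (Fin n → A) → K) :
    SatisfiesExchange θ h μ fun I J z => g (z ∘ J) * F I J z := by
  intro z hz a b hab I J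
  simp only [comp_swap_comp_swap_mul]
  linear_combination g (z ∘ J) * hF hz hab I J

theorem mul_row (hF : SatisfiesExchange θ h μ F) (σ : Equiv.Perm (Fin n)) :
    SatisfiesExchange θ h (μ ∘ ⇑σ⁻¹) fun I J z => F (I * σ) J z := by
  intro z hz a b hab I J
  simpa only [mul_inv_rev, Equiv.Perm.mul_apply, mul_assoc, Function.comp_apply]
    using hF hz hab (I * σ) J

theorem mul_column (hF : SatisfiesExchange θ h μ F) (σ : Equiv.Perm (Fin n)) :
    SatisfiesExchange θ h μ fun I J z => F I (J * σ) z := by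
  intro z hz a b hab I J
  simpa only [mul_assoc] using hF hz hab I (J * σ)

theorem eq_of_one (hF : SatisfiesExchange θ h μ F) (hG : SatisfiesExchange θ h μ G)
    (hμ : IsGeneric θ h μ) (hone : ∀ z, IsGeneric θ h z → ∀ J, F 1 J z = G 1 J z)
    (I J : Equiv.Perm (Fin n)) (hz : IsGeneric θ h z) : F I J z = G I J z := by
  cases n with
  | zero => rw [Subsingleton.elim I 1, hone z hz]
  | succ n =>
    have hI : I ∈ Submonoid.closure
        (Set.range fun i : Fin n => Equiv.swap i.castSucc i.succ) := by
      rw [Equiv.Perm.mclosure_swap_castSucc_succ]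
      trivial
    induction hI using Submonoid.closure_induction_left generalizing J z with
    | one => exact hone z hz J
    | mul_left x hx I _ ih =>
      obtain ⟨i, rfl⟩ := hx
      have hne : i.succ ≠ i.castSucc := i.castSucc_lt_succ.ne'
      have hF := hF hz (a := i.castSucc) (b := i.succ) (by simp) I J
      rw [ih _ hz, ih _ (hz.comp (Equiv.swap i.castSucc i.succ).injective)] at hF
      exact mul_left_cancel₀ (mul_ne_zero (hμ (I⁻¹.injective.ne hne)).2 (hz hne).1)
        (hF.trans (hG hz (by simp) I J).symm)

end SatisfiesExchange

variable {I J : Equiv.Perm (Fin n)} {a b : Fin n}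

theorem IsFay.fixedWeight_exchange_of_lt (hθ : IsFay θ) (hz : IsGeneric θ h z)
    {r₁ r₂ : Fin n} (hr : r₁ < r₂) (hI : (I r₂ : ℕ) = I r₁ + 1) :
    θ (h + (μ r₂ - μ r₁)) * θ (z (I r₂) - z (I r₁)) *
        fixedWeight θ h (Equiv.swap (I r₁) (I r₂) * I) J z μ =
      θ h * θ (z (I r₂) - z (I r₁) + (μ r₂ - μ r₁)) * fixedWeight θ h I J z μ -
        θ (h + (z (I r₁) - z (I r₂))) * θ (μ r₂ - μ r₁) * fixedWeight θ h I
          (Equiv.swap (I r₁) (I r₂) * J) (z ∘ Equiv.swap (I r₁) (I r₂)) μ := by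
  have hswap : Equiv.swap (I r₁) (I r₂) * I = I * Equiv.swap r₁ r₂ :=
    (Equiv.mul_swap_eq_swap_mul I r₁ r₂).symm
  have hcomp : z ∘ ⇑(I * Equiv.swap r₁ r₂) = (z ∘ Equiv.swap (I r₁) (I r₂)) ∘ I := by
    rw [← hswap, Equiv.Perm.coe_mul, Function.comp_assoc]
  have hexchange := hθ.partialWeight_exchange (k := n) (h := h) (I := extendPerm I)
    (w := extendParam (z ∘ J)) (μ := extendParam μ) hr r₂.2 (by simpa using hI)
    (by simpa only [extendParam_val] using hz.comp J.injective) (extendParam (z ∘ I))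
  rw [← extendPerm_swap, ← extendParam_comp, ← map_mul, Function.comp_assoc, ← Equiv.Perm.coe_mul,
    hcomp] at hexchange
  simp only [extendParam_val, Function.comp_apply] at hexchange
  simpa only [fixedWeight, ← extendParam_comp, comp_swap_comp_swap_mul, hswap, hcomp]
    using hexchange

theorem IsFay.satisfiesExchange_fixedWeight (hθ : IsFay θ) (hμ : IsGeneric θ h μ) :
    SatisfiesExchange θ h μ fun I J z => fixedWeight θ h I J z μ := by
  intro z hz a b hab I J
  have hne : a ≠ b := by
    rintro rfl
    omega
  obtain ⟨r₁, rfl⟩ := I.surjective a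
  obtain ⟨r₂, rfl⟩ := I.surjective b
  simp only [Equiv.Perm.coe_inv, Equiv.symm_apply_apply]
  obtain hr | hr := lt_or_gt_of_ne (ne_of_apply_ne I hne)
  · exact hθ.fixedWeight_exchange_of_lt hz hr hab
  set s := Equiv.swap (I r₁) (I r₂) with hs
  have hs₁ : (s * I) r₁ = I r₂ := Equiv.swap_apply_left _ _
  have hs₂ : (s * I) r₂ = I r₁ := Equiv.swap_apply_right _ _
  have h₁ := hθ.fixedWeight_exchange_of_lt (J := J) (μ := μ) (I := s * I) hz hr (by rwa [hs₁, hs₂])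
  have h₂ := hθ.fixedWeight_exchange_of_lt (J := s * J) (μ := μ) (I := s * I)
    (hz.comp s.injective) hr (by rwa [hs₁, hs₂])
  rw [hs₁, hs₂, ← hs, Equiv.swap_mul_self_mul] at h₁
  rw [hs₁, hs₂, ← hs, Equiv.swap_mul_self_mul, Equiv.swap_mul_self_mul,
    Function.comp_assoc, ← Equiv.Perm.coe_mul, Equiv.swap_mul_self, Equiv.Perm.coe_one,
    Function.comp_id, Function.comp_apply, Function.comp_apply, hs, Equiv.swap_apply_left,
    Equiv.swap_apply_right, ← hs] at h₂
  have hm := (hμ hr.ne').2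
  have hZ := (hz hne.symm).1
  rw [← neg_sub (μ r₂) (μ r₁)] at h₁ h₂ hm
  rw [← neg_sub (z (I r₂)) (z (I r₁))] at h₁ h₂ ⊢
  generalize μ r₂ - μ r₁ = m at *
  generalize z (I r₂) - z (I r₁) = Z at *
  rw [← neg_add] at h₂
  simp only [hθ.neg, ← sub_eq_add_neg] at h₁ h₂ hm ⊢
  refine mul_left_cancel₀ (mul_ne_zero hm hZ) ?_
  linear_combination -fixedWeight θ h (s * I) J z μ * hθ.quadratic_relation (h := h) Z m -
    θ h * θ (Z + m) * h₁ - θ (h - Z) * θ m * h₂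

end Recursion

section Mirror

theorem prod_Iio_comp_swap {M : Type*} [CommMonoid M] {n : ℕ} {a b : Fin n}
    (hab : (b : ℕ) = a + 1) (f : Fin n → Fin n → M) :
    (∏ k, ∏ i ∈ Iio k, f (Equiv.swap a b k) (Equiv.swap a b i)) * f b a =
      (∏ k, ∏ i ∈ Iio k, f k i) * f a b := by
  have hlt : a < b := Fin.lt_def.mpr (by omega)
  have hmem : (⟨b, a⟩ : Σ _ : Fin n, Fin n) ∈ univ.sigma fun k => Iio k := by simpa using hlt
  have hmaps (x : Σ _ : Fin n, Fin n) (hx : x ∈ (univ.sigma fun k => Iio k).erase ⟨b, a⟩) :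
      (⟨Equiv.swap a b x.1, Equiv.swap a b x.2⟩ : Σ _ : Fin n, Fin n) ∈
        (univ.sigma fun k => Iio k).erase ⟨b, a⟩ := by
    obtain ⟨c, d⟩ := x
    simp only [mem_erase, mem_sigma, mem_univ, mem_Iio, true_and, ne_eq, Sigma.mk.injEq,
      heq_eq_eq, Equiv.swap_apply_def, Fin.lt_def, Fin.ext_iff] at hx ⊢
    split_ifs <;> omega
  have hrest : ∏ x ∈ (univ.sigma fun k : Fin n => Iio k).erase ⟨b, a⟩,
      f (Equiv.swap a b x.1) (Equiv.swap a b x.2) =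
      ∏ x ∈ (univ.sigma fun k : Fin n => Iio k).erase ⟨b, a⟩, f x.1 x.2 :=
    prod_nbij' (fun x => ⟨Equiv.swap a b x.1, Equiv.swap a b x.2⟩)
      (fun x => ⟨Equiv.swap a b x.1, Equiv.swap a b x.2⟩) hmaps hmaps (by simp) (by simp) (by simp)
  simp only [prod_sigma']
  rw [← mul_prod_erase _ _ hmem, ← mul_prod_erase _ _ hmem, hrest]
  simp only [Equiv.swap_apply_left, Equiv.swap_apply_right]
  rw [mul_right_comm, mul_comm (f a b), mul_right_comm]

variable {A K : Type*} [AddCommGroup A] [Field K] {n : ℕ} {θ : A → K} {h : A} {z μ : Fin n → A}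
  {a b : Fin n}

theorem IsFay.fixedWeight_one (hθ : IsFay θ) (hz : IsGeneric θ h z) :
    fixedWeight θ h 1 1 z μ =
      (∏ k : Fin n, ∏ i ∈ Iio k, θ (h + (μ k - μ i))) *
        ∏ k : Fin n, ∏ i ∈ Iio k, θ (z k - z i) := by
  rw [hθ.fixedWeight_self hz]
  simp only [← prod_mul_distrib]
  refine prod_congr rfl fun k _ => prod_congr rfl fun i hi => ?_
  rw [Equiv.Perm.one_apply, Equiv.Perm.one_apply, if_neg (mem_Iio.mp hi).not_gt]

theorem IsFay.fixedWeight_one_param_swap (hθ : IsFay θ) (hz : IsGeneric θ h z)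
    (hab : (b : ℕ) = a + 1) :
    fixedWeight θ h 1 1 z (μ ∘ Equiv.swap a b) * θ (h + (μ b - μ a)) =
      fixedWeight θ h 1 1 z μ * θ (h + (μ a - μ b)) := by
  rw [hθ.fixedWeight_one hz, hθ.fixedWeight_one hz]
  simp only [Function.comp_apply]
  linear_combination (∏ k : Fin n, ∏ i ∈ Iio k, θ (z k - z i)) *
    prod_Iio_comp_swap hab fun i j => θ (h + (μ i - μ j))

theorem IsFay.fixedWeight_one_comp_swap (hθ : IsFay θ) (hz : IsGeneric θ h z)
    (hab : (b : ℕ) = a + 1) :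
    fixedWeight θ h 1 1 (z ∘ Equiv.swap a b) μ = -fixedWeight θ h 1 1 z μ := by
  have hne : b ≠ a := by
    rintro rfl
    omega
  rw [hθ.fixedWeight_one hz, hθ.fixedWeight_one (hz.comp (Equiv.swap a b).injective)]
  have hprod := prod_Iio_comp_swap hab fun i j => θ (z i - z j)
  rw [hθ.sub_swap (z a)] at hprod
  refine mul_right_cancel₀ (hz hne).1 ?_
  simp only [Function.comp_apply]
  linear_combination (∏ k : Fin n, ∏ i ∈ Iio k, θ (h + (μ k - μ i))) * hprod

theorem IsFay.fixedWeight_swap (hθ : IsFay θ) (hz : IsGeneric θ h z) (hμ : IsGeneric θ h μ)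
    (hab : (b : ℕ) = a + 1) (J : Equiv.Perm (Fin n)) :
    θ (h + (μ a - μ b)) * θ (z (J b) - z (J a)) * fixedWeight θ h (Equiv.swap a b) J z μ =
      θ h * θ (z (J b) - z (J a) + (μ b - μ a)) * fixedWeight θ h 1 J z (μ ∘ Equiv.swap a b) -
        θ (h + (z (J b) - z (J a))) * θ (μ b - μ a) *
          fixedWeight θ h 1 (J * Equiv.swap a b) z (μ ∘ Equiv.swap a b) := by
  have hne : b ≠ a := by
    rintro rfl
    omega
  have hzero {J : Equiv.Perm (Fin n)} (hJ : J ≠ 1) (z μ : Fin n → A) :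
      fixedWeight θ h 1 J z μ = 0 := hθ.fixedWeight_eq_zero hJ.symm (Or.inl rfl)
  have hs : Equiv.swap a b ≠ 1 := fun h => hne (Equiv.swap_eq_one_iff.mp h).symm
  have hm := (hμ hne).2
  have hparam := hθ.fixedWeight_one_param_swap (μ := μ) hz hab
  have hrow := hθ.satisfiesExchange_fixedWeight hμ hz hab 1 J
  simp only [inv_one, Equiv.Perm.one_apply, mul_one] at hrow
  obtain rfl | hJ := eq_or_ne J 1
  · simp only [mul_one, one_mul, Equiv.Perm.one_apply, hzero hs, mul_zero, sub_zero] at hrow ⊢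
    refine mul_left_cancel₀ hm ?_
    linear_combination θ (h + (μ a - μ b)) * hrow - θ h * θ (z b - z a + (μ b - μ a)) * hparam
  obtain rfl | hJs := eq_or_ne J (Equiv.swap a b)
  · simp only [Equiv.swap_mul_self, hzero hs, mul_zero, zero_sub, Equiv.swap_apply_left,
      Equiv.swap_apply_right, hθ.fixedWeight_one_comp_swap hz hab] at hrow ⊢
    rw [hθ.sub_swap (z a)]
    refine mul_left_cancel₀ hm ?_
    linear_combination -θ (h + (μ a - μ b)) * hrow + θ (h + (z a - z b)) * θ (μ b - μ a) * hparam
  · have hrow_ne : Equiv.swap a b * J ≠ 1 := by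
      rwa [Ne, mul_eq_one_iff_inv_eq, Equiv.swap_inv, eq_comm]
    have hcol_ne : J * Equiv.swap a b ≠ 1 := by
      rwa [Ne, mul_eq_one_iff_eq_inv, Equiv.swap_inv]
    rw [hzero hJ, hzero hrow_ne, mul_zero, mul_zero, sub_zero] at hrow
    have := (mul_eq_zero.mp hrow).resolve_left (mul_ne_zero hm (hz hne).1)
    rw [this, hzero hJ, hzero hcol_ne, mul_zero, mul_zero, mul_zero, sub_zero]

theorem IsFay.fixedWeight_mul_swap (hθ : IsFay θ) (hz : IsGeneric θ h z) (hμ : IsGeneric θ h μ)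
    (hab : (b : ℕ) = a + 1) (I J : Equiv.Perm (Fin n)) :
    θ (h + (μ a - μ b)) * θ (z (J b) - z (J a)) * fixedWeight θ h (I * Equiv.swap a b) J z μ =
      θ h * θ (z (J b) - z (J a) + (μ b - μ a)) * fixedWeight θ h I J z (μ ∘ Equiv.swap a b) -
        θ (h + (z (J b) - z (J a))) * θ (μ b - μ a) *
          fixedWeight θ h I (J * Equiv.swap a b) z (μ ∘ Equiv.swap a b) := by
  set s := Equiv.swap a b with hs
  have hμs := hμ.comp s.injective
  have hrow := (hθ.satisfiesExchange_fixedWeight hμ).mul_row s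
  rw [hs, Equiv.swap_inv, ← hs] at hrow
  have hcol := hθ.satisfiesExchange_fixedWeight hμs
  refine (hrow.mul_comp fun x => θ (h + (μ a - μ b)) * θ (x b - x a)).eq_of_one
    ((hcol.mul_comp fun x => θ h * θ (x b - x a + (μ b - μ a))).sub
      ((hcol.mul_column s).mul_comp fun x => θ (h + (x b - x a)) * θ (μ b - μ a)))
    hμs (fun z hz J => ?_) I J hz
  rw [one_mul]
  exact hθ.fixedWeight_swap hz hμ hab J

/-- The matrix on the other side of the mirror symmetry, up to sign. -/
def mirrorWeight (θ : A → K) (h : A) (I J : Equiv.Perm (Fin n)) (z μ : Fin n → A) : K :=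
  fixedWeight θ h (Fin.revPerm * J⁻¹) (Fin.revPerm * I⁻¹) (μ ∘ Fin.revPerm) (-z)

theorem IsFay.satisfiesExchange_mirrorWeight (hθ : IsFay θ) (hμ : IsGeneric θ h μ) :
    SatisfiesExchange θ h μ fun I J z => mirrorWeight θ h I J z μ := by
  intro z hz a b hab I J
  have hswap := hθ.fixedWeight_mul_swap (hμ.comp Fin.revPerm.injective)
    (hz.neg.comp (Equiv.swap a b).injective) hab (Fin.revPerm * J⁻¹) (Fin.revPerm * I⁻¹)
  rw [Function.comp_assoc (-z), ← Equiv.Perm.coe_mul, Equiv.swap_mul_self, Equiv.Perm.coe_one,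
    Function.comp_id] at hswap
  simp only [Function.comp_apply, Equiv.swap_apply_left, Equiv.swap_apply_right, Pi.neg_apply,
    neg_sub_neg, Equiv.Perm.mul_apply, Fin.revPerm_apply, Fin.rev_rev] at hswap
  have hneg : -(z ∘ Equiv.swap a b) = (-z) ∘ Equiv.swap a b := rfl
  simp only [mirrorWeight, mul_inv_rev, Equiv.swap_inv, ← mul_assoc, hneg]
  rw [add_comm (z b - z a)]
  linear_combination hswap

theorem IsFay.fixedWeight_one_eq_mirrorWeight (hθ : IsFay θ) (hz : IsGeneric θ h z)
    (hμ : IsGeneric θ h μ) (J : Equiv.Perm (Fin n)) :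
    fixedWeight θ h 1 J z μ = (-1) ^ (n * (n - 1) / 2) * mirrorWeight θ h 1 J z μ := by
  obtain rfl | hJ := eq_or_ne J 1
  · have hsign : (-1 : K) ^ (n * (n - 1) / 2) = ∏ k : Fin n, ∏ a ∈ Iio k, (-1 : K) := by
      rw [← Finset.sum_range_id, ← prod_pow_eq_pow_sum, prod_range]
      refine prod_congr rfl fun k _ => ?_
      rw [prod_const, Fin.card_Iio]
    rw [hθ.fixedWeight_one hz, mirrorWeight, inv_one, mul_one,
      hθ.fixedWeight_self (hμ.comp Fin.revPerm.injective), hsign]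
    simp only [← prod_mul_distrib]
    refine prod_congr rfl fun k _ => prod_congr rfl fun a ha => ?_
    rw [if_pos (by simpa using mem_Iio.mp ha), hθ.sub_swap (z k)]
    simp only [Function.comp_apply, Fin.revPerm_apply, Fin.rev_rev, Pi.neg_apply, neg_sub_neg]
    ring
  · rw [hθ.fixedWeight_eq_zero hJ.symm (Or.inl rfl), mirrorWeight, hθ.fixedWeight_eq_zero, mul_zero]
    · simpa using hJ
    · exact Or.inr (by rw [inv_one, mul_one])

theorem IsFay.fixedWeight_eq_mirrorWeight (hθ : IsFay θ) (hz : IsGeneric θ h z)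
    (hμ : IsGeneric θ h μ) (I J : Equiv.Perm (Fin n)) :
    fixedWeight θ h I J z μ = (-1) ^ (n * (n - 1) / 2) * mirrorWeight θ h I J z μ :=
  (hθ.satisfiesExchange_fixedWeight hμ).eq_of_one
    ((hθ.satisfiesExchange_mirrorWeight hμ).mul_comp fun _ => (-1) ^ (n * (n - 1) / 2)) hμ
    (fun _ hz J => hθ.fixedWeight_one_eq_mirrorWeight hz hμ J) I J hz

end Mirror

section Labelling

theorem partialWeight_eq_sum {A K : Type*} [AddCommGroup A] [Field K] (θ : A → K) (h : A)
    (I : Equiv.Perm ℕ) (μ w : ℕ → A) (n : ℕ) (y : ℕ → A) :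
    partialWeight θ h I μ w n y = ∑ τ : (k : Fin n) → Equiv.Perm (Fin k), ∏ k : Fin n,
      kern θ h I μ k
        (Fin.snoc (α := fun _ => ℕ → A) (fun j => w ∘ extendPerm (τ j)) y k.castSucc)
        (Fin.snoc (α := fun _ => ℕ → A) (fun j => w ∘ extendPerm (τ j)) y k.succ) := by
  induction n generalizing y with
  | zero => simp [partialWeight]
  | succ n ih =>
    rw [← (Fin.snocEquiv fun k : Fin (n + 1) => Equiv.Perm (Fin k)).sum_comp,
      Fintype.sum_prod_type, partialWeight]
    refine sum_congr rfl fun σ _ => ?_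
    rw [ih, sum_mul]
    refine sum_congr rfl fun τ _ => ?_
    have hlabels : (fun j => w ∘ extendPerm (Fin.snocEquiv
        (fun k : Fin (n + 1) => Equiv.Perm (Fin k)) (σ, τ) j)) =
        Fin.snoc (α := fun _ => ℕ → A) (fun j => w ∘ extendPerm (τ j)) (w ∘ extendPerm σ) := by
      funext j
      induction j using Fin.lastCases <;> simp [Fin.snocEquiv]
    rw [Fin.prod_univ_castSucc, hlabels]
    simp only [Fin.snoc_castSucc, Fin.succ_castSucc, Fin.succ_last, Fin.snoc_last,
      Fin.val_castSucc, Fin.val_last]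

variable {n : ℕ} {q : ℂ}

theorem exists_sortedIndex_eq (I : Equiv.Perm (Fin n)) (k : Fin (n + 1)) :
    ∃ ρ : Equiv.Perm (Fin k), ∀ m : Fin k, sortedIndex I k (ρ m) = I (m.castLE k.is_le) := by
  have hmem (m : Fin k) : I (m.castLE k.is_le) ∈ initialSet I k := by
    simp [initialSet]
  let position : Fin k → Fin k := fun m =>
    ((initialSet I k).orderIsoOfFin (card_initialSet I k)).symm ⟨_, hmem m⟩
  have hposition : Function.Injective position := by
    intro a b hab
    have := ((initialSet I k).orderIsoOfFin (card_initialSet I k)).symm.injective hab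
    simpa using this
  refine ⟨Equiv.ofBijective position (Finite.injective_iff_bijective.mp hposition), fun m => ?_⟩
  rw [Equiv.ofBijective_apply, sortedIndex, ← coe_orderIsoOfFin_apply]
  simp only [position, OrderIso.apply_symm_apply]

theorem sortedIndex_last (I : Equiv.Perm (Fin n)) (m : Fin n) :
    sortedIndex I (Fin.last n) m = m := by
  have h := orderEmbOfFin_unique (card_initialSet I (Fin.last n)) (f := fun m : Fin n => m)
    (fun m => by simp [initialSet]) strictMono_id
  exact (congrFun h m).symm

theorem extendRoots_castSucc (t : ChernRoots n) (z : Fin n → ℂ) (k : Fin n) :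
    extendRoots t z k.castSucc = t k :=
  Fin.snoc_castSucc (α := fun k : Fin (n + 1) => Fin k → ℂ) z t k

theorem extendRoots_last (t : ChernRoots n) (z : Fin n → ℂ) :
    extendRoots t z (Fin.last n) = z :=
  Fin.snoc_last (α := fun k : Fin (n + 1) => Fin k → ℂ) z t

/-- The theta function on the group of non-zero complex numbers, written additively as in the
exponents of a monomial. -/
def unitTheta (q : ℂ) (x : Additive ℂˣ) : ℂ := theta q (x.toMul : ℂˣ)

theorem isFay_unitTheta (hq0 : q ≠ 0) (hq : ‖q‖ < 1) : IsFay (unitTheta q) where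
  neg x := by simp only [unitTheta, toMul_neg, Units.val_inv_eq_inv_val, theta_inv]
  fay x y l m := by
    simpa only [unitTheta, toMul_add, toMul_sub, Units.val_mul, Units.val_div_eq_div_val] using
      theta_fay hq0 hq x.toMul.ne_zero y.toMul.ne_zero l.toMul.ne_zero m.toMul.ne_zero

variable {I J : Equiv.Perm (Fin n)} {h : Additive ℂˣ} {μ : Fin n → Additive ℂˣ}
  {ρ : (k : Fin (n + 1)) → Equiv.Perm (Fin k)}

theorem psi_eq_entry (hρ : ∀ k m, sortedIndex I k (ρ k m) = I (m.castLE k.is_le)) (k : Fin n)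
    (a : Fin k.castSucc) (c : Fin k.succ) (x : Additive ℂˣ) :
    psi q h.toMul (fun i => (μ i).toMul) I k (ρ k.castSucc a) (ρ k.succ c) x.toMul =
      entry (unitTheta q) h (extendPerm I) (extendParam μ) k a c x := by
  have hIa : extendPerm I a = I (a.castLE k.castSucc.is_le) :=
    extendPerm_val I (a.castLE k.castSucc.is_le)
  have hIc : extendPerm I c = I (c.castLE k.succ.is_le) :=
    extendPerm_val I (c.castLE k.succ.is_le)
  have hμa : extendParam μ a = μ (a.castLE k.castSucc.is_le) :=
    extendParam_val μ (a.castLE k.castSucc.is_le)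
  have heq : c.castLE k.succ.is_le = a.castLE k.castSucc.is_le ↔ (c : ℕ) = a := Fin.ext_iff
  simp only [psi, entry, hρ, hIa, hIc, hμa, extendPerm_val, extendParam_val, ← Fin.lt_def,
    EmbeddingLike.apply_eq_iff_eq, heq, Equiv.symm_apply_apply, pFun]
  refine if_congr Iff.rfl ?_ (if_congr Iff.rfl ?_ rfl)
  · simp only [unitTheta, toMul_add, Units.val_mul]
  · split_ifs
    · simp only [unitTheta, toMul_add, toMul_sub, Units.val_mul, Units.val_div_eq_div_val, sub_self,
        zpow_zero, mul_one, zero_add, mul_div_assoc]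
    · simp only [unitTheta, toMul_add, toMul_sub, Units.val_mul, Units.val_div_eq_div_val, sub_zero,
        zpow_one, mul_assoc, mul_div_assoc]

theorem preWeight_eq_prod_kern
    (hρ : ∀ k m, sortedIndex I k (ρ k m) = I (m.castLE k.is_le)) {t : ChernRoots n}
    {z : Fin n → ℂ} {x : Fin (n + 1) → ℕ → Additive ℂˣ}
    (ht : ∀ k m, extendRoots t z k (ρ k m) = (x k m).toMul) :
    preWeight q h.toMul I t z (fun i => (μ i).toMul) =
      ∏ k : Fin n, kern (unitTheta q) h (extendPerm I) (extendParam μ) k (x k.castSucc)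
        (x k.succ) := by
  refine prod_congr rfl fun k _ => congrArg₂ (· / ·) ?_ ?_
  · rw [prod_product, prod_range]
    refine (Fintype.prod_equiv (ρ k.castSucc) _ _ fun a => ?_).symm
    rw [prod_range]
    refine Fintype.prod_equiv (ρ k.succ) _ _ fun c => ?_
    rw [ht, ht, ← psi_eq_entry hρ k, toMul_sub, Units.val_div_eq_div_val]
  · rw [prod_product, prod_range]
    refine (Fintype.prod_equiv (ρ k.castSucc) _ _ fun a => ?_).symm
    rw [prod_range, ← Finset.filter_lt_eq_Ioi, prod_filter]
    refine Fintype.prod_equiv (ρ k.castSucc) _ _ fun b => ?_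
    have hroot (a : Fin k) : t k (ρ k.castSucc a) = (x k.castSucc a).toMul := by
      rw [← ht, extendRoots_castSucc]
    have hI (a : Fin k) : extendPerm I a = I (a.castLE k.2.le) :=
      extendPerm_val I (a.castLE k.2.le)
    have hlt : ρ k.castSucc a < ρ k.castSucc b ↔ extendPerm I a < extendPerm I b := by
      rw [← (sortedIndex I k.castSucc).lt_iff_lt, hρ, hρ, hI, hI]
      rfl
    refine if_congr hlt.symm ?_ rfl
    rw [hroot, hroot]
    simp only [unitTheta, toMul_add, toMul_sub, Units.val_mul, Units.val_div_eq_div_val,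
      mul_div_assoc, mul_comm]

theorem restrictionMatrix_eq_fixedWeight (I J : Equiv.Perm (Fin n)) (h : Additive ℂˣ)
    (z μ : Fin n → Additive ℂˣ) :
    restrictionMatrix q h.toMul I J (fun i => (z i).toMul) (fun i => (μ i).toMul) =
      fixedWeight (unitTheta q) h I J z μ := by
  choose ρ hρ using exists_sortedIndex_eq I
  choose ρ' hρ' using exists_sortedIndex_eq J
  rw [fixedWeight, partialWeight_eq_sum, restrictionMatrix, weight]
  let π (k : Fin n) : Equiv.Perm (Fin k) := ρ k.castSucc
  let π' (k : Fin n) : Equiv.Perm (Fin k) := ρ' k.castSucc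
  let renumber : ((k : Fin n) → Equiv.Perm (Fin k)) ≃ ((k : Fin n) → Equiv.Perm (Fin k)) :=
    Equiv.piCongrRight fun k => (Equiv.mulLeft (π' k)).trans (Equiv.mulRight (π k)⁻¹)
  refine (Fintype.sum_equiv renumber _ _ fun τ => ?_).symm
  refine (preWeight_eq_prod_kern hρ fun k m => ?_).symm
  induction k using Fin.lastCases with
  | last =>
    have hlast := hρ (Fin.last n) m
    rw [sortedIndex_last] at hlast
    rw [extendRoots_last, Fin.snoc_last, hlast, Function.comp_apply]
    exact congrArg (fun x : Additive ℂˣ => (x.toMul : ℂ))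
      ((congrFun (extendParam_comp z I).symm m).trans (extendParam_val _ m)).symm
  | cast k =>
    have hrenumber : renumber τ k (ρ k.castSucc m) = ρ' k.castSucc (τ k m) := by
      change (π' k * τ k * (π k)⁻¹) (π k m) = π' k (τ k m)
      simp
    rw [extendRoots_castSucc, Fin.snoc_castSucc, hrenumber, fixedPointRoots, hρ',
      ← extendParam_comp, Function.comp_apply, extendPerm_val (τ k)]
    exact congrArg (fun x : Additive ℂˣ => (x.toMul : ℂ))
      (extendParam_val (z ∘ J) ((τ k m).castLE k.2.le)).symm

end Labelling

section Continuity

variable {n : ℕ} {q : ℂ}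

theorem theta_toMul (x : Additive ℂˣ) : theta q (x.toMul : ℂˣ) = unitTheta q x := rfl

theorem continuous_unitTheta (hq : ‖q‖ < 1) : Continuous (unitTheta q) :=
  continuous_iff_continuousAt.mpr fun x =>
    (continuousAt_theta hq x.toMul.ne_zero).comp
      (Units.continuous_val.comp continuous_toMul).continuousAt

theorem continuous_psi (hq : ‖q‖ < 1) (I : Equiv.Perm (Fin n)) (k : Fin n) (a : Fin k.castSucc)
    (c : Fin k.succ) :
    Continuous fun p : Additive ℂˣ × (Fin n → Additive ℂˣ) × Additive ℂˣ =>
      psi q p.1.toMul (fun i => (p.2.1 i).toMul) I k a c p.2.2.toMul := by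
  have hθ := continuous_unitTheta hq
  unfold psi
  simp only [← Units.val_zpow_eq_zpow_val, ← Units.val_mul, ← Units.val_div_eq_div_val,
    ← toMul_zsmul, ← toMul_add, ← toMul_sub, theta_toMul]
  split_ifs <;> fun_prop

theorem exists_extendRoots_fixedPointRoots_eq (J : Equiv.Perm (Fin n))
    (τ : (k : Fin n) → Equiv.Perm (Fin k)) (k : Fin (n + 1)) (a : Fin k) :
    ∃ i : Fin n, ∀ z : Fin n → ℂ,
      extendRoots (fun k a => fixedPointRoots z J k (τ k a)) z k a = z i := by
  induction k using Fin.lastCases with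
  | last => exact ⟨a, fun z => by rw [extendRoots_last]⟩
  | cast k => exact ⟨_, fun z => by rw [extendRoots_castSucc, fixedPointRoots]⟩

/-- The parameters `(ħ, z, μ)` as elements of a topological group, written additively. -/
abbrev Parameters (n : ℕ) : Type :=
  Additive ℂˣ × (Fin n → Additive ℂˣ) × (Fin n → Additive ℂˣ)

/-- The parameters `(ħ, (μ_n, …, μ_1), z⁻¹)` of the matrix on the other side of the mirror
symmetry. -/
def Parameters.mirror (p : Parameters n) : Parameters n := (p.1, p.2.2 ∘ Fin.revPerm, -p.2.1)

/-- The restriction matrix as a function on the group of parameters. -/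
def Parameters.matrix (q : ℂ) (I J : Equiv.Perm (Fin n)) (p : Parameters n) : ℂ :=
  restrictionMatrix q p.1.toMul I J (fun i => (p.2.1 i).toMul) (fun i => (p.2.2 i).toMul)

theorem Parameters.continuous_mirror : Continuous (mirror (n := n)) := by
  unfold mirror
  fun_prop

theorem Parameters.continuousAt_matrix (hq : ‖q‖ < 1) (I J : Equiv.Perm (Fin n)) {p : Parameters n}
    (hp : DenominatorsNonzero q p.1.toMul (fixedPointRoots (fun i => (p.2.1 i).toMul) J)) :
    ContinuousAt (matrix q I J) p := by
  have hθ := continuous_unitTheta hq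
  unfold matrix restrictionMatrix weight preWeight
  refine tendsto_finsetSum _ fun τ _ => tendsto_finsetProd _ fun k _ => Filter.Tendsto.div
    (tendsto_finsetProd _ fun a _ => tendsto_finsetProd _ fun c _ => ?_)
    (tendsto_finsetProd _ fun a _ => tendsto_finsetProd _ fun b _ => ?_) ?_
  · obtain ⟨i, hi⟩ := exists_extendRoots_fixedPointRoots_eq J τ k.succ c
    obtain ⟨j, hj⟩ := exists_extendRoots_fixedPointRoots_eq J τ k.castSucc a
    simp only [hi, hj, ← Units.val_div_eq_div_val, ← toMul_sub]
    have hψ := continuous_psi hq I k a c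
    exact (hψ.comp (f := fun p : Parameters n => (p.1, p.2.2, p.2.1 i - p.2.1 j))
      (by fun_prop)).continuousAt
  · simp only [fixedPointRoots, ← Units.val_div_eq_div_val, ← Units.val_mul, ← toMul_sub,
      ← toMul_add, theta_toMul]
    exact Continuous.continuousAt (by fun_prop)
  · refine prod_ne_zero_iff.mpr fun a _ => prod_ne_zero_iff.mpr fun b hb => ?_
    have := hp k (τ k a) (τ k b) ((τ k).injective.ne (mem_Ioi.mp hb).ne)
    exact mul_ne_zero this.1 this.2

end Continuity

section Genericity

variable {n : ℕ} {q : ℂ}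

/-- The one-parameter subgroup `x ↦ exp x` of the non-zero complex numbers, used to move parameters
into general position. -/
def expHom : ℝ →+ Additive ℂˣ where
  toFun x := Additive.ofMul (Units.mk0 (Complex.exp x) (Complex.exp_ne_zero _))
  map_zero' := Additive.toMul.injective (Units.ext (by simp))
  map_add' x y := Additive.toMul.injective (Units.ext (by simp [Complex.exp_add]))

theorem val_toMul_expHom (x : ℝ) : ((expHom x).toMul : ℂ) = Complex.exp x := rfl

theorem continuous_expHom : Continuous expHom := by
  refine continuous_ofMul.comp (Units.isEmbedding_val₀.continuous_iff.mpr ?_)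
  exact Complex.continuous_exp.comp Complex.continuous_ofReal

theorem eventually_unitTheta_add_expHom_ne_zero (hq : ‖q‖ < 1) (x : Additive ℂˣ) {c : ℝ}
    (hc : c ≠ 0) : ∀ᶠ ε in Filter.cocountable, unitTheta q (x + expHom (ε * c)) ≠ 0 := by
  have hzeros (k : ℤ) : {ε : ℝ | ((x + expHom (ε * c)).toMul : ℂ) ^ 2 = q ^ k}.Subsingleton := by
    intro ε₁ h₁ ε₂ h₂
    have := h₁.trans h₂.symm
    simp only [toMul_add, Units.val_mul, mul_pow, val_toMul_expHom] at this
    rw [mul_right_inj' (pow_ne_zero 2 x.toMul.ne_zero)] at this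
    norm_cast at this
    simpa [pow_left_inj₀, hc, Real.exp_pos, (Real.exp_pos _).le] using this
  have hall : ∀ k : ℤ, ∀ᶠ ε in Filter.cocountable, ((x + expHom (ε * c)).toMul : ℂ) ^ 2 ≠ q ^ k :=
    fun k => Filter.mem_cocountable.mpr (by
      simpa [Set.compl_def] using (hzeros k).countable)
  have : CountableInterFilter (Filter.cocountable : Filter ℝ) :=
    cardinalInterFilter_aleph_one_iff.mp inferInstance
  filter_upwards [eventually_countable_forall.mpr hall] with ε hε
  exact theta_ne_zero hq (Units.ne_zero _) hε

/-- The tuple `z` moved along a path with distinct speeds. -/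
def deform (z : Fin n → Additive ℂˣ) (ε : ℝ) (i : Fin n) : Additive ℂˣ :=
  z i + expHom (ε * (i : ℕ))

theorem eventually_isGeneric_deform (hq : ‖q‖ < 1) (h : Additive ℂˣ) (z : Fin n → Additive ℂˣ) :
    ∀ᶠ ε in Filter.cocountable, IsGeneric (unitTheta q) (h + expHom (ε * n)) (deform z ε) := by
  refine Filter.eventually_all.mpr fun i => Filter.eventually_all.mpr fun j => ?_
  refine Filter.eventually_imp_distrib_left.mpr fun hij => ?_
  have hsub : ((i : ℕ) - (j : ℕ) : ℝ) ≠ 0 := sub_ne_zero.mpr (mod_cast Fin.val_ne_of_ne hij)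
  have hshift : (n + ((i : ℕ) - (j : ℕ)) : ℝ) ≠ 0 := by
    have : n + (i : ℕ) ≠ (j : ℕ) := by omega
    rw [← add_sub_assoc, sub_ne_zero]
    exact_mod_cast this
  filter_upwards [eventually_unitTheta_add_expHom_ne_zero hq (z i - z j) hsub,
    eventually_unitTheta_add_expHom_ne_zero hq (h + (z i - z j)) hshift] with ε h₁ h₂
  rw [mul_add, mul_sub, map_add, map_sub] at h₂
  rw [mul_sub, map_sub] at h₁
  rw [deform, deform, add_sub_add_comm, add_add_add_comm]
  exact ⟨h₁, h₂⟩

theorem frequently_isGeneric (hq : ‖q‖ < 1) (p : Parameters n) :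
    ∃ᶠ p in nhds p, IsGeneric (unitTheta q) p.1 p.2.1 ∧ IsGeneric (unitTheta q) p.1 p.2.2 := by
  let path : ℝ → Parameters n := fun ε =>
    (p.1 + expHom (ε * n), deform p.2.1 ε, deform p.2.2 ε)
  have hpath : Continuous path := by
    have := continuous_expHom
    unfold path deform
    fun_prop
  have hpath_zero : path 0 = p := by simp [path, deform, funext_iff, Prod.ext_iff]
  have hgeneric := (eventually_isGeneric_deform hq p.1 p.2.1).and
    (eventually_isGeneric_deform hq p.1 p.2.2)
  have hdense := (Filter.mem_cocountable.mp hgeneric).dense_compl ℝ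
  rw [compl_compl] at hdense
  have htendsto := hpath.tendsto 0
  rw [hpath_zero] at htendsto
  exact htendsto.frequently (mem_closure_iff_frequently.mp (hdense 0))

end Genericity

theorem Parameters.matrix_eq_of_isGeneric {n : ℕ} {q : ℂ} (hq0 : q ≠ 0) (hq : ‖q‖ < 1)
    {p : Parameters n} (hz : IsGeneric (unitTheta q) p.1 p.2.1)
    (hμ : IsGeneric (unitTheta q) p.1 p.2.2) (I J : Equiv.Perm (Fin n)) :
    p.matrix q I J = (-1) ^ (n * (n - 1) / 2) *
      p.mirror.matrix q (J.symm.trans Fin.revPerm) (I.symm.trans Fin.revPerm) := by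
  rw [matrix, matrix, restrictionMatrix_eq_fixedWeight, restrictionMatrix_eq_fixedWeight]
  exact (isFay_unitTheta hq0 hq).fixedWeight_eq_mirrorWeight hz hμ I J

theorem Parameters.matrix_eq {n : ℕ} {q : ℂ} (hq0 : q ≠ 0) (hq : ‖q‖ < 1) (p : Parameters n)
    (I J : Equiv.Perm (Fin n))
    (hleft : DenominatorsNonzero q p.1.toMul (fixedPointRoots (fun i => (p.2.1 i).toMul) J))
    (hright : DenominatorsNonzero q p.mirror.1.toMul
      (fixedPointRoots (fun i => (p.mirror.2.1 i).toMul) (I.symm.trans Fin.revPerm))) :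
    p.matrix q I J = (-1) ^ (n * (n - 1) / 2) *
      p.mirror.matrix q (J.symm.trans Fin.revPerm) (I.symm.trans Fin.revPerm) :=
  tendsto_nhds_unique_of_frequently_eq (continuousAt_matrix hq I J hleft)
    (((continuousAt_matrix hq _ _ hright).comp continuous_mirror.continuousAt).const_mul _)
    ((frequently_isGeneric hq p).mono fun _ hp => matrix_eq_of_isGeneric hq0 hq hp.1 hp.2 I J)

end FlagMirror

end

theorem mainTheorem2 (n : ℕ) (q : ℂ) (hq0 : q ≠ 0) (hq1 : ‖q‖ < 1)
    (h : ℂ) (z μ : Fin n → ℂ) (hh : h ≠ 0) (hz : ∀ i, z i ≠ 0) (hμ : ∀ i, μ i ≠ 0)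
    (I J : Equiv.Perm (Fin n))
    (hL : FlagMirror.DenominatorsNonzero q h (FlagMirror.fixedPointRoots z J))
    (hR : FlagMirror.DenominatorsNonzero q h
      (FlagMirror.fixedPointRoots (fun i => μ (Fin.revPerm i)) (I.symm.trans Fin.revPerm))) :
    FlagMirror.restrictionMatrix q h I J z μ =
      (-1 : ℂ) ^ (n * (n - 1) / 2) *
        FlagMirror.restrictionMatrix q h
          (J.symm.trans Fin.revPerm) (I.symm.trans Fin.revPerm)
          (fun i => μ (Fin.revPerm i)) (fun i => (z i)⁻¹) := by
  lift h to ℂˣ using hh.isUnit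
  lift z to Fin n → ℂˣ using fun i => (hz i).isUnit
  lift μ to Fin n → ℂˣ using fun i => (hμ i).isUnit
  have hgroup := FlagMirror.Parameters.matrix_eq hq0 hq1
    (.ofMul h, fun i => .ofMul (z i), fun i => .ofMul (μ i)) I J hL hR
  simpa only [FlagMirror.Parameters.matrix, FlagMirror.Parameters.mirror, Function.comp_apply,
    Pi.neg_apply, toMul_neg, toMul_ofMul, Units.val_inv_eq_inv_val] using hgroup
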